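/- Let $\mathbb{T}=\mathbb{R}/\mathbb{Z}$, let $u_0\in C^2(\mathbb{T})$, and let $F\in C^2(\mathbb{R}^2)$ be convex and nondecreasing in each of its two variables. For $h\neq 0$ and $v:\mathbb{T}\to\mathbb{R}$ put $\delta_h v(x)=\frac{v(x+h)-v(x)}{h}$. For every $h>0$ there is a unique function $u^h$, continuous on $\mathbb{T}\times[0,\infty)$ and differentiable in $t$ for $t>0$, such that $$u^h_t+F\left(-\delta_h u^h,\delta_{-h}u^h\right)=0\ \text{ in }\mathbb{T}\times(0,\infty),\qquad u^h(\cdot,0)=u_0\ \text{ on }\mathbb{T}.$$ Moreover, there is a constant $C>0$, depending only on $F$ and $u_0$, such that for all $h>0$ and $t>0$ the derivative $u^h_h(x,t)=\frac{\partial u^h}{\partial h}(x,t)$ exists for every $x\in\mathbb{T}$, is continuous in $x$, and satisfies $$\max_{x\in\mathbb{T}}u^h_h(x,t)\le C\,t,\qquad \min_{x\in\mathbb{T}}u^h_h(x,t)\ge-\frac{C(1+t)}{\sqrt h},\qquad \left\|u^h_h(\cdot,t)\right\|_{L^\infty(\mathbb{T})}\le\frac{C(1+t)}{\sqrt h}.$$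 -/

import Mathlib

/-- The finite difference quotient `δ_h v (x) = (v (x + h) - v x) / h` of a function on the
one-dimensional torus `ℝ / ℤ`; the backward quotient `δ_{-h}` is `torusDiffQuot (-h)`. -/
noncomputable def torusDiffQuot (h : ℝ) (v : UnitAddCircle → ℝ) (x : UnitAddCircle) : ℝ :=
  (v (x + (h : UnitAddCircle)) - v x) / h

/-- `u` (a function of `(x, t)`, considered for `t ≥ 0`) is a solution of the semi-discrete problem
`u_t + F (-δ_h u, δ_{-h} u) = 0` in `𝕋 × (0, ∞)`, with `u = u₀` on `𝕋 × {t = 0}`. -/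
structure IsSchemeSolution (F : ℝ × ℝ → ℝ) (u₀ : UnitAddCircle → ℝ) (h : ℝ)
    (u : UnitAddCircle → ℝ → ℝ) : Prop where
  continuousOn : ContinuousOn (fun z : UnitAddCircle × ℝ => u z.1 z.2) (Set.univ ×ˢ Set.Ici 0)
  hasDerivAt : ∀ x : UnitAddCircle, ∀ t : ℝ, 0 < t →
    HasDerivAt (fun s => u x s)
      (-F (-torusDiffQuot h (fun y => u y t) x, torusDiffQuot (-h) (fun y => u y t) x)) t
  initial : ∀ x : UnitAddCircle, u x 0 = u₀ x

open Set Filter Topology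

/-! With p = (u(x) - u(x+h))/h and q = (u(x) - u(x-h))/h the scheme reads u_t + F(p, q) = 0. Both
quotients increase with u(x), so at a spatial maximum of a difference of two solutions the
monotonicity of F has the favourable sign. This gives a comparison principle
(`semidiscrete_comparison`), hence uniqueness, a priori bounds and preservation of Lipschitz
constants. Existence is Picard–Lindelöf in C(𝕋), since for fixed h the quotients are bounded
operators.

The candidates v for u_x and w for u_h are constructed as solutions of the formally differentiated
equations, both linear with the monotone operator DF(p, q)·D, where D denotes the pair of quotients.
They are then identified with derivatives: u(·+y) and u + y v, and likewise u^{h+ε} and u^h + ε w,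
solve the same scheme up to small errors, so comparison bounds their distance
(`IsSpaceDerivative.exists_abs_shift_sub_le`, `IsStepDerivative.abs_sub_le`).

The equation of w has zero initial datum and source DF·S, where S = (u(x) - u(x+s) + s v(x+s))/h²
for s = ±h. Convexity of F propagates u(x+y) ≤ u(x) + y v(x) + K y² in time with K independent of h
(`IsSpaceDerivative.shift_le`). Centred at x+s this gives S ≤ K, hence w ≤ Ct. Centred at x it gives
only S ≥ -|Dv| - K. The lower bound then rests on the identity D(v²) = 2v Dv - h(Dv)²: the
dissipation in the equation for θv² absorbs |Dv| at cost 1/(4θh), and θ = 1/(2√h) balances this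
against the size of θv² (`IsStepDerivative.neg_le_of_semiconcave`). For h ≥ 1 the crude bound |S| ≤
2L/h suffices for the norm estimate. -/

/-- The quotient `(v x - v (x + s)) / h`, monotone in `v x`. -/
noncomputable def stepDiff (s h : ℝ) (v : UnitAddCircle → ℝ) (x : UnitAddCircle) : ℝ :=
  (v x - v (x + (s : UnitAddCircle))) / h

/-! ### Maximum and comparison principles -/

theorem HasDerivAt.nonneg_of_forall_mem_Icc_le {g : ℝ → ℝ} {g' a t : ℝ} (hg : HasDerivAt g g' t)
    (hat : a < t) (hle : ∀ s, a ≤ s → s ≤ t → g s ≤ g t) : 0 ≤ g' := by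
  have h1 : Tendsto (slope g t) (𝓝[<] t) (𝓝 g') :=
    (hasDerivWithinAt_iff_tendsto_slope' (by simp)).1 (hg.hasDerivWithinAt (s := Iio t))
  refine ge_of_tendsto h1 ?_
  filter_upwards [Ioo_mem_nhdsLT hat] with s hs
  rw [slope_def_field]
  exact div_nonneg_of_nonpos (by linarith [hle s hs.1.le hs.2.le]) (by linarith [hs.2])

/-- Maximum principle: growth of a function on `𝕋 × [0, T]` is controlled by its time derivative
at spatial maximum points. -/
theorem le_add_mul_of_deriv_le_at_max {z z' : UnitAddCircle → ℝ → ℝ} {T m c : ℝ}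
    (hz : ContinuousOn (fun y : UnitAddCircle × ℝ => z y.1 y.2) (univ ×ˢ Icc 0 T))
    (hd : ∀ x t, 0 < t → t ≤ T → HasDerivAt (z x) (z' x t) t)
    (h0 : ∀ x, z x 0 ≤ m)
    (hmax : ∀ x t, 0 < t → t ≤ T → (∀ y, z y t ≤ z x t) → z' x t ≤ c)
    (x : UnitAddCircle) (t : ℝ) (ht : 0 ≤ t) (htT : t ≤ T) : z x t ≤ m + c * t := by
  by_contra! hlt
  -- Raising the slope to c + ε, with ε t at most half of the excess, keeps the violation and makes
  -- the final inequality strict.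
  obtain ⟨ε, hε, hεt⟩ : ∃ ε : ℝ, 0 < ε ∧ m + (c + ε) * t < z x t := by
    refine ⟨(z x t - (m + c * t)) / (2 * (t + 1)), by apply div_pos <;> linarith, ?_⟩
    have : (z x t - (m + c * t)) / (2 * (t + 1)) * t ≤ (z x t - (m + c * t)) / 2 := by
      rw [div_mul_eq_mul_div, div_le_div_iff₀ (by positivity) (by positivity)]
      nlinarith
    linarith
  obtain ⟨⟨x₀, t₀⟩, ⟨-, ht₀⟩, hM⟩ :=
    (isCompact_univ.prod (isCompact_Icc (a := (0 : ℝ)) (b := T))).exists_isMaxOn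
      ⟨(x, t), mem_univ _, ht, htT⟩
      (f := fun y : UnitAddCircle × ℝ => z y.1 y.2 - (c + ε) * y.2) (by fun_prop)
  have hM' : ∀ y s, 0 ≤ s → s ≤ T → z y s - (c + ε) * s ≤ z x₀ t₀ - (c + ε) * t₀ :=
    fun y s hs hs' => hM (a := (y, s)) ⟨mem_univ _, hs, hs'⟩
  -- A maximum at time 0 would have value at most m, contradicting the violation at (x, t).
  have hpos : 0 < t₀ := by
    rcases ht₀.1.eq_or_lt with h | h
    · have h1 := hM' x t ht htT
      have h2 := h0 x₀
      simp only at h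
      rw [← h] at h1
      linarith
    · exact h
  have hder : HasDerivAt (fun s => z x₀ s - (c + ε) * s) (z' x₀ t₀ - (c + ε)) t₀ := by
    have := (hd x₀ t₀ hpos ht₀.2).sub ((hasDerivAt_id t₀).const_mul (c + ε))
    rwa [mul_one] at this
  have h1 := hder.nonneg_of_forall_mem_Icc_le hpos fun s hs hs' => hM' x₀ s hs (hs'.trans ht₀.2)
  have h2 := hmax x₀ t₀ hpos ht₀.2 fun y => by linarith [hM' y t₀ ht₀.1 ht₀.2]
  linarith

theorem stepDiff_nonneg_of_forall_le {s h : ℝ} (hh : 0 < h) {v : UnitAddCircle → ℝ}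
    {x : UnitAddCircle} (hx : ∀ y, v y ≤ v x) : 0 ≤ stepDiff s h v x :=
  div_nonneg (sub_nonneg.2 (hx _)) hh.le

theorem stepDiff_sub (s h : ℝ) (v w : UnitAddCircle → ℝ) (x : UnitAddCircle) :
    stepDiff s h (fun y => v y - w y) x = stepDiff s h v x - stepDiff s h w x := by
  unfold stepDiff; ring

theorem stepDiff_add (s h : ℝ) (v w : UnitAddCircle → ℝ) (x : UnitAddCircle) :
    stepDiff s h (fun y => v y + w y) x = stepDiff s h v x + stepDiff s h w x := by
  unfold stepDiff; ring

theorem stepDiff_const_mul (s h c : ℝ) (v : UnitAddCircle → ℝ) (x : UnitAddCircle) :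
    stepDiff s h (fun y => c * v y) x = c * stepDiff s h v x := by
  unfold stepDiff; ring

theorem stepDiff_shift (s h : ℝ) (v : UnitAddCircle → ℝ) (y x : UnitAddCircle) :
    stepDiff s h (fun z => v (z + y)) x = stepDiff s h v (x + y) := by
  unfold stepDiff; rw [add_right_comm]

/-- Comparison principle for semi-discrete equations that are monotone in both quotients. -/
theorem semidiscrete_comparison {Φ : UnitAddCircle → ℝ → ℝ → ℝ → ℝ} {h T m c : ℝ} (hh : 0 < h)
    (hΦ : ∀ x t p p' q q', p ≤ p' → q ≤ q' → Φ x t p q ≤ Φ x t p' q')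
    {a a' b b' : UnitAddCircle → ℝ → ℝ}
    (ha : ContinuousOn (fun y : UnitAddCircle × ℝ => a y.1 y.2) (univ ×ˢ Icc 0 T))
    (hb : ContinuousOn (fun y : UnitAddCircle × ℝ => b y.1 y.2) (univ ×ˢ Icc 0 T))
    (ha' : ∀ x t, 0 < t → t ≤ T → HasDerivAt (a x) (a' x t) t)
    (hb' : ∀ x t, 0 < t → t ≤ T → HasDerivAt (b x) (b' x t) t)
    (h0 : ∀ x, a x 0 ≤ b x 0 + m)
    (hle : ∀ x t, 0 < t → t ≤ T →
      a' x t + Φ x t (stepDiff h h (a · t) x) (stepDiff (-h) h (a · t) x) ≤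
        b' x t + Φ x t (stepDiff h h (b · t) x) (stepDiff (-h) h (b · t) x) + c)
    (x : UnitAddCircle) (t : ℝ) (ht : 0 ≤ t) (htT : t ≤ T) : a x t ≤ b x t + (m + c * t) := by
  have := le_add_mul_of_deriv_le_at_max (z := fun x t => a x t - b x t)
    (z' := fun x t => a' x t - b' x t) (T := T) (m := m) (c := c) (ha.sub hb)
    (fun x t h1 h2 => (ha' x t h1 h2).sub (hb' x t h1 h2)) (fun x => by linarith [h0 x])
    (fun x t h1 h2 h3 => by
      -- At a spatial maximum of a - b the quotients of a dominate those of b, so Φ at a is at least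
      -- Φ at b.
      have e1 := stepDiff_nonneg_of_forall_le (s := h) hh h3
      have e2 := stepDiff_nonneg_of_forall_le (s := -h) hh h3
      rw [stepDiff_sub] at e1 e2
      have := hΦ x t _ _ _ _ (sub_nonneg.1 e1) (sub_nonneg.1 e2)
      linarith [hle x t h1 h2]) x t ht htT
  linarith

/-! ### Existence for monotone semi-discrete equations -/

theorem abs_stepDiff_sub_le {h : ℝ} (hh : 0 < h) (s : ℝ) (v w : C(UnitAddCircle, ℝ))
    (x : UnitAddCircle) : |stepDiff s h v x - stepDiff s h w x| ≤ 2 / h * ‖v - w‖ := by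
  have e : stepDiff s h v x - stepDiff s h w x = ((v - w) x - (v - w) (x + (s : UnitAddCircle))) / h := by
    simp only [stepDiff, ContinuousMap.sub_apply]; ring
  have h1 := (v - w).norm_coe_le_norm x
  have h2 := (v - w).norm_coe_le_norm (x + (s : UnitAddCircle))
  rw [Real.norm_eq_abs] at h1 h2
  rw [e, abs_div, abs_of_pos hh, div_mul_eq_mul_div]
  gcongr
  exact (abs_sub _ _).trans (by linarith)

/-- Existence on a compact time interval for a bounded, Lipschitz nonlinearity. -/
theorem exists_semidiscrete_of_bounded {Ψ : UnitAddCircle → ℝ → ℝ → ℝ → ℝ}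
    (hc : Continuous fun y : UnitAddCircle × ℝ × ℝ × ℝ => Ψ y.1 y.2.1 y.2.2.1 y.2.2.2)
    {h T B K : ℝ} (hh : 0 < h) (hT : 0 ≤ T)
    (hB : ∀ x t p q, t ∈ Icc 0 T → |Ψ x t p q| ≤ B)
    (hK : ∀ x t p p' q q', t ∈ Icc 0 T → |Ψ x t p q - Ψ x t p' q'| ≤ K * (|p - p'| + |q - q'|))
    (v₀ : C(UnitAddCircle, ℝ)) :
    ∃ v : UnitAddCircle → ℝ → ℝ,
      ContinuousOn (fun y : UnitAddCircle × ℝ => v y.1 y.2) (univ ×ˢ Icc 0 T) ∧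
      (∀ x t, 0 < t → t < T → HasDerivAt (v x)
        (-Ψ x t (stepDiff h h (v · t) x) (stepDiff (-h) h (v · t) x)) t) ∧
      ∀ x, v x 0 = v₀ x := by
  have hB0 : 0 ≤ B := (abs_nonneg _).trans (hB 0 0 0 0 ⟨le_rfl, hT⟩)
  have hK0 : 0 ≤ K := by
    have := (abs_nonneg _).trans (hK 0 0 1 0 0 0 ⟨le_rfl, hT⟩)
    simpa using this
  let f : ℝ → C(UnitAddCircle, ℝ) → C(UnitAddCircle, ℝ) := fun t v =>
    ⟨fun x => -Ψ x t (stepDiff h h v x) (stepDiff (-h) h v x), by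
      unfold stepDiff
      refine (hc.comp (f := fun x => (x, t, (v x - v (x + (h : UnitAddCircle))) / h,
        (v x - v (x + ((-h : ℝ) : UnitAddCircle))) / h)) ?_).neg
      fun_prop⟩
  -- The radius B T is the farthest a curve of speed B travels, so one application covers all of [0,
  -- T]. The factor 4/h collects 2/h from each of the two quotients.
  have hf : IsPicardLindelof f (tmin := 0) (tmax := T) ⟨0, le_rfl, hT⟩ v₀ (B * T).toNNReal 0
      B.toNNReal (K * (4 / h)).toNNReal := by
    refine ⟨fun t ht => ?_, fun v _ => ?_, fun t ht v _ => ?_, ?_⟩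
    · refine LipschitzOnWith.of_dist_le_mul fun v _ w _ => ?_
      rw [Real.coe_toNNReal _ (by positivity), ContinuousMap.dist_le (by positivity)]
      intro x
      rw [Real.dist_eq, dist_eq_norm]
      have h1 := abs_stepDiff_sub_le hh h v w x
      have h2 := abs_stepDiff_sub_le hh (-h) v w x
      calc |f t v x - f t w x| = |Ψ x t (stepDiff h h v x) (stepDiff (-h) h v x) -
            Ψ x t (stepDiff h h w x) (stepDiff (-h) h w x)| := by
              rw [← abs_neg]; congr 1; simp only [f, ContinuousMap.coe_mk]; ring
        _ ≤ K * (2 / h * ‖v - w‖ + 2 / h * ‖v - w‖) := (hK _ _ _ _ _ _ ht).trans (by gcongr)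
        _ = K * (4 / h) * ‖v - w‖ := by ring
    · refine (ContinuousMap.continuous_of_continuous_uncurry _ ?_).continuousOn
      refine (hc.comp (f := fun y : ℝ × UnitAddCircle => (y.2, y.1,
        (v y.2 - v (y.2 + (h : UnitAddCircle))) / h,
        (v y.2 - v (y.2 + ((-h : ℝ) : UnitAddCircle))) / h)) ?_).neg
      fun_prop
    · rw [Real.coe_toNNReal _ hB0, ContinuousMap.norm_le _ hB0]
      intro x
      simp only [f, ContinuousMap.coe_mk, norm_neg, Real.norm_eq_abs]
      exact hB _ _ _ _ ht
    · simp [hT, hB0, mul_nonneg]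
  obtain ⟨α, hα0, hα⟩ := hf.exists_eq_forall_mem_Icc_hasDerivWithinAt₀
  refine ⟨fun x t => α t x, ?_, fun x t ht htT => ?_, fun x => by rw [← hα0]⟩
  · have h1 : ContinuousOn α (Icc 0 T) := fun t ht => (hα t ht).continuousWithinAt
    have h2 : ContinuousOn (fun y : UnitAddCircle × ℝ => α y.2) (univ ×ˢ Icc 0 T) :=
      h1.comp continuousOn_snd fun y hy => hy.2
    exact continuous_eval.comp_continuousOn (h2.prodMk continuousOn_fst)
  · have h1 := (hα t ⟨ht.le, htT.le⟩).hasDerivAt (Icc_mem_nhds ht htT)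
    exact (ContinuousMap.evalCLM ℝ x).hasFDerivAt.comp_hasDerivAt t h1

/-- The dependence of Φ on (x, t) lets the scheme and its linearizations share one existence and
comparison theory. -/
structure IsSemidiscreteSolution (Φ : UnitAddCircle → ℝ → ℝ → ℝ → ℝ) (h : ℝ)
    (v₀ : UnitAddCircle → ℝ) (v : UnitAddCircle → ℝ → ℝ) : Prop where
  continuousOn : ContinuousOn (fun z : UnitAddCircle × ℝ => v z.1 z.2) (univ ×ˢ Ici 0)
  hasDerivAt : ∀ x t, 0 < t → HasDerivAt (v x)
    (-Φ x t (stepDiff h h (v · t) x) (stepDiff (-h) h (v · t) x)) t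
  initial : ∀ x, v x 0 = v₀ x

theorem IsSemidiscreteSolution.continuousOn_Icc {Φ : UnitAddCircle → ℝ → ℝ → ℝ → ℝ} {h : ℝ}
    {v₀ : UnitAddCircle → ℝ} {v : UnitAddCircle → ℝ → ℝ} (hv : IsSemidiscreteSolution Φ h v₀ v)
    (T : ℝ) : ContinuousOn (fun z : UnitAddCircle × ℝ => v z.1 z.2) (univ ×ˢ Icc 0 T) :=
  hv.continuousOn.mono (prod_mono le_rfl Icc_subset_Ici_self)

/-- Truncation of a real number to `[-R, R]`. -/
def truncate (R p : ℝ) : ℝ := max (-R) (min p R)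

theorem truncate_mono (R : ℝ) : Monotone (truncate R) := fun _ _ hpq =>
  max_le_max le_rfl (min_le_min hpq le_rfl)

theorem abs_truncate_le {R : ℝ} (hR : 0 ≤ R) (p : ℝ) : |truncate R p| ≤ R :=
  abs_le.2 ⟨le_max_left _ _, max_le (by linarith) (min_le_right _ _)⟩

theorem truncate_of_abs_le {R p : ℝ} (hp : |p| ≤ R) : truncate R p = p := by
  rw [truncate, min_eq_left (abs_le.1 hp).2, max_eq_right (abs_le.1 hp).1]

theorem abs_truncate_sub_le (R p q : ℝ) : |truncate R p - truncate R q| ≤ |p - q| := by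
  have : LipschitzWith 1 (truncate R) := (LipschitzWith.id.min_const R).const_max (-R)
  simpa [Real.dist_eq] using this.dist_le_mul p q

theorem continuous_truncate (R : ℝ) : Continuous (truncate R) := by
  unfold truncate; fun_prop

theorem stepDiff_const (s h m : ℝ) (x : UnitAddCircle) : stepDiff s h (fun _ => m) x = 0 := by
  simp [stepDiff]

theorem abs_stepDiff_le_of_abs_le {s h B : ℝ} (hh : 0 < h) {v : UnitAddCircle → ℝ}
    (hv : ∀ y, |v y| ≤ B) (x : UnitAddCircle) : |stepDiff s h v x| ≤ 2 * B / h := by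
  rw [stepDiff, abs_div, abs_of_pos hh]
  gcongr
  exact (abs_sub _ _).trans (by linarith [hv x, hv (x + (s : UnitAddCircle))])

/-- Existence on a compact time interval for a monotone, locally Lipschitz nonlinearity. -/
theorem exists_semidiscrete_Icc {Φ : UnitAddCircle → ℝ → ℝ → ℝ → ℝ}
    (hc : Continuous fun y : UnitAddCircle × ℝ × ℝ × ℝ => Φ y.1 y.2.1 y.2.2.1 y.2.2.2)
    (hmono : ∀ x t p p' q q', p ≤ p' → q ≤ q' → Φ x t p q ≤ Φ x t p' q')
    (hlip : ∀ T R, ∃ K, ∀ x t p p' q q', t ∈ Icc 0 T → |p| ≤ R → |p'| ≤ R → |q| ≤ R → |q'| ≤ R →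
      |Φ x t p q - Φ x t p' q'| ≤ K * (|p - p'| + |q - q'|))
    {h T : ℝ} (hh : 0 < h) (hT : 0 ≤ T) (v₀ : C(UnitAddCircle, ℝ)) :
    ∃ v : UnitAddCircle → ℝ → ℝ,
      ContinuousOn (fun y : UnitAddCircle × ℝ => v y.1 y.2) (univ ×ˢ Icc 0 T) ∧
      (∀ x t, 0 < t → t < T → HasDerivAt (v x)
        (-Φ x t (stepDiff h h (v · t) x) (stepDiff (-h) h (v · t) x)) t) ∧
      ∀ x, v x 0 = v₀ x := by
  obtain ⟨c, hc0⟩ := (isCompact_univ.prod (isCompact_Icc (a := (0 : ℝ)) (b := T))).exists_bound_of_continuousOn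
    (f := fun y : UnitAddCircle × ℝ => Φ y.1 y.2 0 0)
    (hc.comp (f := fun y : UnitAddCircle × ℝ => (y.1, y.2, 0, 0)) (by fun_prop)).continuousOn
  have hcb : ∀ x t, t ∈ Icc 0 T → |Φ x t 0 0| ≤ c := fun x t ht => hc0 (x, t) ⟨mem_univ _, ht⟩
  have hcnn : 0 ≤ c := (abs_nonneg _).trans (hcb 0 0 ⟨le_rfl, hT⟩)
  -- Comparison with 0 gives |v| ≤ ‖v₀‖ + cT, so the quotients never exceed R and truncating there
  -- changes nothing.
  set R := 2 * (‖v₀‖ + c * T) / h with hR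
  have hRnn : 0 ≤ R := by positivity
  obtain ⟨K, hK⟩ := hlip T R
  -- If R = 0 the Lipschitz hypothesis says nothing about the sign of K.
  have hKnn : 0 ≤ K * R ∧ (0 < R → 0 ≤ K) := by
    have h1 := (abs_nonneg _).trans (hK 0 0 R 0 0 0 ⟨le_rfl, hT⟩ (abs_of_nonneg hRnn).le
      (by simpa using hRnn) (by simpa using hRnn) (by simpa using hRnn))
    simp only [sub_zero, abs_zero, add_zero, abs_of_nonneg hRnn] at h1
    exact ⟨h1, fun h2 => nonneg_of_mul_nonneg_left h1 h2⟩
  have htr := abs_truncate_le hRnn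
  let Ψ : UnitAddCircle → ℝ → ℝ → ℝ → ℝ := fun x t p q => Φ x t (truncate R p) (truncate R q)
  have hΨ0 : ∀ x t, Ψ x t 0 0 = Φ x t 0 0 := fun x t => by
    simp only [Ψ, truncate_of_abs_le (show |(0 : ℝ)| ≤ R by simpa using hRnn)]
  have hΨmono : ∀ x t p p' q q', p ≤ p' → q ≤ q' → Ψ x t p q ≤ Ψ x t p' q' :=
    fun x t p p' q q' hp hq => hmono _ _ _ _ _ _ (truncate_mono R hp) (truncate_mono R hq)
  obtain ⟨v, hvc, hvd, hv0⟩ := exists_semidiscrete_of_bounded (Ψ := Ψ) (B := c + 2 * (K * R))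
    (K := |K|)
    (hc.comp (f := fun y : UnitAddCircle × ℝ × ℝ × ℝ =>
      (y.1, y.2.1, truncate R y.2.2.1, truncate R y.2.2.2)) (by
        have := continuous_truncate R
        fun_prop)) hh hT
    (fun x t p q ht => by
      have h1 := hK x t (truncate R p) 0 (truncate R q) 0 ht (htr _) (by simpa using hRnn) (htr _)
        (by simpa using hRnn)
      rw [sub_zero, sub_zero] at h1
      have h2 : K * (|truncate R p| + |truncate R q|) ≤ 2 * (K * R) := by
        rcases hRnn.eq_or_lt with h3 | h3
        · have h4 := htr p
          have h5 := htr q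
          rw [← h3] at h4 h5 ⊢
          rw [le_antisymm h4 (abs_nonneg _), le_antisymm h5 (abs_nonneg _)]
          simp
        · have := mul_le_mul_of_nonneg_left (add_le_add (htr p) (htr q)) (hKnn.2 h3)
          linarith
      have h3 := hcb x t ht
      have h4 := abs_sub_abs_le_abs_sub (Φ x t (truncate R p) (truncate R q)) (Φ x t 0 0)
      simp only [Ψ]
      linarith)
    (fun x t p p' q q' ht => by
      refine (hK x t _ _ _ _ ht (htr p) (htr p') (htr q) (htr q')).trans ?_
      refine (mul_le_mul_of_nonneg_right (le_abs_self K) (by positivity)).trans ?_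
      exact mul_le_mul_of_nonneg_left (add_le_add (abs_truncate_sub_le _ _ _)
        (abs_truncate_sub_le _ _ _)) (abs_nonneg _)) v₀
  have hv0' : ∀ x, |v x 0| ≤ ‖v₀‖ := fun x => by rw [hv0]; exact v₀.norm_coe_le_norm x
  have hvb : ∀ t, 0 < t → t < T → ∀ x, |v x t| ≤ ‖v₀‖ + c * T := by
    intro t ht htT x
    have hsub : ContinuousOn (fun y : UnitAddCircle × ℝ => v y.1 y.2) (univ ×ˢ Icc 0 t) :=
      hvc.mono (prod_mono le_rfl (Icc_subset_Icc_right htT.le))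
    have hct : c * t ≤ c * T := mul_le_mul_of_nonneg_left htT.le hcnn
    have h1 := semidiscrete_comparison hh hΨmono (T := t) (b := fun _ _ => 0) (b' := fun _ _ => 0)
      (m := ‖v₀‖) (c := c) hsub continuousOn_const (fun x s hs hst => hvd x s hs (hst.trans_lt htT))
      (fun x s _ _ => hasDerivAt_const _ _)
      (fun x => by linarith [(abs_le.1 (hv0' x)).2]) (fun x s hs hst => by
        simp only [stepDiff_const, hΨ0]
        linarith [(abs_le.1 (hcb x s ⟨hs.le, hst.trans htT.le⟩)).1]) x t ht.le le_rfl
    have h2 := semidiscrete_comparison hh hΨmono (T := t) (a := fun _ _ => 0) (a' := fun _ _ => 0)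
      (m := ‖v₀‖) (c := c) continuousOn_const hsub (fun x s _ _ => hasDerivAt_const _ _)
      (fun x s hs hst => hvd x s hs (hst.trans_lt htT))
      (fun x => by linarith [(abs_le.1 (hv0' x)).1]) (fun x s hs hst => by
        simp only [stepDiff_const, hΨ0]
        linarith [(abs_le.1 (hcb x s ⟨hs.le, hst.trans htT.le⟩)).2]) x t ht.le le_rfl
    exact abs_le.2 ⟨by linarith, by linarith⟩
  refine ⟨v, hvc, fun x t ht htT => ?_, hv0⟩
  have h1 := hvd x t ht htT
  simp only [Ψ] at h1
  rwa [truncate_of_abs_le (abs_stepDiff_le_of_abs_le hh (hvb t ht htT) x),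
    truncate_of_abs_le (abs_stepDiff_le_of_abs_le hh (hvb t ht htT) x)] at h1

/-- Global existence for a monotone, locally Lipschitz nonlinearity. -/
theorem exists_isSemidiscreteSolution {Φ : UnitAddCircle → ℝ → ℝ → ℝ → ℝ}
    (hc : Continuous fun y : UnitAddCircle × ℝ × ℝ × ℝ => Φ y.1 y.2.1 y.2.2.1 y.2.2.2)
    (hmono : ∀ x t p p' q q', p ≤ p' → q ≤ q' → Φ x t p q ≤ Φ x t p' q')
    (hlip : ∀ T R, ∃ K, ∀ x t p p' q q', t ∈ Icc 0 T → |p| ≤ R → |p'| ≤ R → |q| ≤ R → |q'| ≤ R →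
      |Φ x t p q - Φ x t p' q'| ≤ K * (|p - p'| + |q - q'|))
    {h : ℝ} (hh : 0 < h) (v₀ : C(UnitAddCircle, ℝ)) :
    ∃ v, IsSemidiscreteSolution Φ h v₀ v := by
  -- The horizon n + 1 puts every t ≥ 0 strictly below the horizon of index ⌈t⌉₊, where a two-sided
  -- time derivative is available for t > 0.
  have hex : ∀ n : ℕ, _ := fun n =>
    exists_semidiscrete_Icc hc hmono hlip hh (T := (n : ℝ) + 1) (by positivity) v₀
  choose U hUc hUd hU0 using hex
  have hle : ∀ (n m : ℕ) x t, 0 ≤ t → t < (n : ℝ) + 1 → t < (m : ℝ) + 1 → U n x t ≤ U m x t := by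
    intro n m x t ht hn hm
    have := semidiscrete_comparison hh hmono (T := t) (a := U n) (b := U m) (m := 0) (c := 0)
      ((hUc n).mono (prod_mono le_rfl (Icc_subset_Icc_right hn.le)))
      ((hUc m).mono (prod_mono le_rfl (Icc_subset_Icc_right hm.le)))
      (fun x s hs hst => hUd n x s hs (hst.trans_lt hn))
      (fun x s hs hst => hUd m x s hs (hst.trans_lt hm))
      (fun x => by rw [hU0, hU0]; linarith) (fun x s _ _ => by linarith) x t ht le_rfl
    linarith
  have heq : ∀ (n : ℕ) x t, 0 ≤ t → t < (n : ℝ) + 1 → U ⌈t⌉₊ x t = U n x t := fun n x t ht hn =>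
    have hlt : t < (⌈t⌉₊ : ℝ) + 1 := (Nat.le_ceil t).trans_lt (lt_add_one _)
    le_antisymm (hle _ _ x t ht hlt hn) (hle _ _ x t ht hn hlt)
  refine ⟨fun x t => U ⌈t⌉₊ x t, ?_, fun x t ht => ?_, fun x => ?_⟩
  · rintro ⟨x, t⟩ ⟨-, ht⟩
    have hlt : t < (⌈t⌉₊ : ℝ) + 1 := (Nat.le_ceil t).trans_lt (lt_add_one _)
    have hnhds : (univ ×ˢ Iio ((⌈t⌉₊ : ℝ) + 1) : Set (UnitAddCircle × ℝ)) ∈ 𝓝 (x, t) :=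
      prod_mem_nhds univ_mem (Iio_mem_nhds hlt)
    have h1 : ContinuousWithinAt (fun y : UnitAddCircle × ℝ => U ⌈t⌉₊ y.1 y.2) (univ ×ˢ Ici 0)
        (x, t) := by
      refine (hUc ⌈t⌉₊ (x, t) ⟨mem_univ _, ht, hlt.le⟩).mono_of_mem_nhdsWithin ?_
      filter_upwards [self_mem_nhdsWithin, mem_nhdsWithin_of_mem_nhds hnhds] with y hy hy'
      exact ⟨mem_univ _, hy.2, hy'.2.le⟩
    refine h1.congr_of_eventuallyEq ?_ (heq _ x t ht hlt)
    filter_upwards [self_mem_nhdsWithin, mem_nhdsWithin_of_mem_nhds hnhds] with y hy hy'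
    exact heq _ y.1 y.2 hy.2 hy'.2
  · have hlt : t < (⌈t⌉₊ : ℝ) + 1 := (Nat.le_ceil t).trans_lt (lt_add_one _)
    refine (hUd ⌈t⌉₊ x t ht hlt).congr_of_eventuallyEq ?_
    filter_upwards [Ioo_mem_nhds ht hlt] with s hs
    exact heq _ x s hs.1.le hs.2
  · exact hU0 _ x

/-! ### Estimates for the C² data u₀ and F -/

theorem Function.Periodic.deriv_one {g : ℝ → ℝ} (hg : Function.Periodic g 1) :
    Function.Periodic (deriv g) 1 := fun x => by
  rw [← deriv_comp_add_const]
  congr 1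
  exact funext hg

theorem Function.Periodic.exists_abs_le {g : ℝ → ℝ} (hg : Function.Periodic g 1)
    (hc : Continuous g) : ∃ B, 0 ≤ B ∧ ∀ x, |g x| ≤ B := by
  obtain ⟨B, hB⟩ := (hg.compact_of_continuous one_ne_zero hc).isBounded.exists_norm_le
  exact ⟨B, (norm_nonneg _).trans (hB _ (mem_range_self 0)), fun x => hB _ (mem_range_self x)⟩

/-- A `C²` function on the circle has a continuous derivative, is Lipschitz, and admits a uniform
second-order Taylor estimate. -/
theorem exists_torus_taylor_data {u₀ : UnitAddCircle → ℝ}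
    (hu₀ : ContDiff ℝ 2 (fun x : ℝ => u₀ (x : UnitAddCircle))) :
    Continuous u₀ ∧ ∃ (u₁ : C(UnitAddCircle, ℝ)) (L K : ℝ), 0 ≤ L ∧ 0 ≤ K ∧ (∀ x, |u₁ x| ≤ L) ∧
      (∀ (x : UnitAddCircle) (y : ℝ), |u₀ (x + (y : UnitAddCircle)) - u₀ x| ≤ L * |y|) ∧
      ∀ (x : UnitAddCircle) (y : ℝ),
        |u₀ (x + (y : UnitAddCircle)) - u₀ x - y * u₁ x| ≤ K * y ^ 2 := by
  set g : ℝ → ℝ := fun x : ℝ => u₀ (x : UnitAddCircle) with hg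
  have hper : Function.Periodic g 1 := fun x => by
    simp only [hg]; rw [AddCircle.coe_add, AddCircle.coe_period, add_zero]
  have hg1 : ContDiff ℝ 1 (deriv g) := ((contDiff_succ_iff_deriv (n := 1)).1 hu₀).2.2
  have hd : Differentiable ℝ g := hu₀.differentiable (by norm_num)
  have hd1 : Differentiable ℝ (deriv g) := hg1.differentiable (by norm_num)
  obtain ⟨L, hL0, hL⟩ := hper.deriv_one.exists_abs_le hg1.continuous
  obtain ⟨K, hK0, hK⟩ := hper.deriv_one.deriv_one.exists_abs_le (hg1.continuous_deriv le_rfl)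
  refine ⟨(QuotientAddGroup.isQuotientMap_mk _).continuous_iff.2 hu₀.continuous,
    ⟨hper.deriv_one.lift, (QuotientAddGroup.isQuotientMap_mk _).continuous_iff.2 hg1.continuous⟩,
    L, K, hL0, hK0, fun x => ?_, fun x y => ?_, fun x y => ?_⟩
  · induction x using QuotientAddGroup.induction_on with
    | H x => exact hL x
  · induction x using QuotientAddGroup.induction_on with
    | H x =>
      have := convex_univ.norm_image_sub_le_of_norm_deriv_le (f := g) (x := x) (y := x + y)
        (fun z _ => hd z) (fun z _ => hL z) (mem_univ _) (mem_univ _)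
      simpa [hg] using this
  · induction x using QuotientAddGroup.induction_on with
    | H x =>
      have hlip : ∀ z ∈ uIcc x (x + y), |deriv g z - deriv g x| ≤ K * |y| := fun z hz => by
        have h1 := convex_univ.norm_image_sub_le_of_norm_deriv_le (f := deriv g) (x := x) (y := z)
          (fun z _ => hd1 z) (fun z _ => hK z) (mem_univ _) (mem_univ _)
        refine h1.trans (mul_le_mul_of_nonneg_left ?_ hK0)
        have := abs_sub_left_of_mem_uIcc hz
        rwa [add_sub_cancel_left] at this
      -- Mean value inequality for g minus its linear part at x, whose derivative is at most K|y| on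
      -- the segment.
      have h2 := (convex_uIcc x (x + y)).norm_image_sub_le_of_norm_deriv_le
        (f := fun z => g z - deriv g x * z) (x := x) (y := x + y) (C := K * |y|)
        (fun z _ => (hd z).sub ((differentiableAt_id).const_mul _)) (fun z hz => by
          have : deriv (fun z => g z - deriv g x * z) z = deriv g z - deriv g x := by
            have := ((hd z).hasDerivAt.sub ((hasDerivAt_id z).const_mul (deriv g x))).deriv
            rwa [mul_one] at this
          rw [this]; exact hlip z hz) left_mem_uIcc right_mem_uIcc
      have e1 : g (x + y) - deriv g x * (x + y) - (g x - deriv g x * x) =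
        g (x + y) - g x - y * deriv g x := by ring
      rw [e1, add_sub_cancel_left, Real.norm_eq_abs, Real.norm_eq_abs, mul_assoc, abs_mul_abs_self,
        ← sq] at h2
      exact h2

/-- The directional derivative of `F : ℝ² → ℝ` at `(p, q)` along `(a, b)`. -/
noncomputable def gradApply (F : ℝ × ℝ → ℝ) (p q a b : ℝ) : ℝ :=
  fderiv ℝ F (p, q) (1, 0) * a + fderiv ℝ F (p, q) (0, 1) * b

theorem gradApply_eq (F : ℝ × ℝ → ℝ) (p q a b : ℝ) :
    gradApply F p q a b = fderiv ℝ F (p, q) (a, b) := by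
  have : ((a, b) : ℝ × ℝ) = a • ((1, 0) : ℝ × ℝ) + b • ((0, 1) : ℝ × ℝ) := by simp
  rw [this, map_add, map_smul, map_smul, gradApply, smul_eq_mul, smul_eq_mul]
  ring

theorem fderiv_fst_nonneg_of_monotone {F : ℝ × ℝ → ℝ} (hF : Differentiable ℝ F)
    (hm : ∀ q : ℝ, Monotone fun p : ℝ => F (p, q)) (z : ℝ × ℝ) : 0 ≤ fderiv ℝ F z (1, 0) := by
  have h1 : HasDerivAt (fun p : ℝ => (p, z.2)) ((1 : ℝ), (0 : ℝ)) z.1 :=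
    (hasDerivAt_id z.1).prodMk (hasDerivAt_const _ _)
  have h2 : HasDerivAt (fun p : ℝ => F (p, z.2)) (fderiv ℝ F z (1, 0)) z.1 :=
    (hF z).hasFDerivAt.comp_hasDerivAt z.1 h1
  rw [← h2.deriv]
  exact (hm z.2).deriv_nonneg

theorem fderiv_snd_nonneg_of_monotone {F : ℝ × ℝ → ℝ} (hF : Differentiable ℝ F)
    (hm : ∀ p : ℝ, Monotone fun q : ℝ => F (p, q)) (z : ℝ × ℝ) : 0 ≤ fderiv ℝ F z (0, 1) := by
  have h1 : HasDerivAt (fun q : ℝ => (z.1, q)) ((0 : ℝ), (1 : ℝ)) z.2 :=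
    (hasDerivAt_const _ _).prodMk (hasDerivAt_id z.2)
  have h2 : HasDerivAt (fun q : ℝ => F (z.1, q)) (fderiv ℝ F z (0, 1)) z.2 :=
    (hF z).hasFDerivAt.comp_hasDerivAt z.2 h1
  rw [← h2.deriv]
  exact (hm z.1).deriv_nonneg

/-- Supporting plane inequality, obtained from the slope of F along a line; it is the only way
convexity of F enters. -/
theorem ConvexOn.add_gradApply_le {F : ℝ × ℝ → ℝ} (hF : Differentiable ℝ F)
    (hconv : ConvexOn ℝ univ F) (p q p' q' : ℝ) :
    F (p, q) + gradApply F p q (p' - p) (q' - q) ≤ F (p', q') := by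
  have h1 : HasDerivAt (fun s : ℝ => AffineMap.lineMap (k := ℝ) (p, q) (p', q') s)
      ((p', q') - (p, q)) 0 := AffineMap.hasDerivAt_lineMap
  have h2 : HasDerivAt (fun s : ℝ => F (AffineMap.lineMap (k := ℝ) (p, q) (p', q') s))
      (fderiv ℝ F (p, q) (p' - p, q' - q)) 0 := by
    have := (hF (AffineMap.lineMap (k := ℝ) (p, q) (p', q') (0 : ℝ))).hasFDerivAt.comp_hasDerivAt 0 h1
    rw [AffineMap.lineMap_apply_zero] at this
    exact this
  have h3 : ConvexOn ℝ univ (fun s : ℝ => F (AffineMap.lineMap (k := ℝ) (p, q) (p', q') s)) :=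
    hconv.comp_affineMap (AffineMap.lineMap (k := ℝ) (p, q) (p', q'))
  have h4 := h3.le_slope_of_hasDerivAt (mem_univ 0) (mem_univ 1) one_pos h2
  rw [slope_def_field] at h4
  simp only [AffineMap.lineMap_apply_zero, AffineMap.lineMap_apply_one, sub_zero, div_one] at h4
  rw [gradApply_eq]
  linarith

theorem mem_closedBall_prod_zero_iff {R p q : ℝ} :
    ((p, q) : ℝ × ℝ) ∈ Metric.closedBall (0 : ℝ × ℝ) R ↔ |p| ≤ R ∧ |q| ≤ R := by
  rw [mem_closedBall_zero_iff, Prod.norm_mk, max_le_iff, Real.norm_eq_abs, Real.norm_eq_abs]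

theorem norm_prod_le_abs_add (a b : ℝ) : ‖((a, b) : ℝ × ℝ)‖ ≤ |a| + |b| :=
  max_le (le_add_of_nonneg_right (abs_nonneg b)) (le_add_of_nonneg_left (abs_nonneg a))

theorem ContDiff.exists_abs_sub_le_of_box {F : ℝ × ℝ → ℝ} (hF : ContDiff ℝ 2 F) (R : ℝ) :
    ∃ K, ∀ p p' q q', |p| ≤ R → |p'| ≤ R → |q| ≤ R → |q'| ≤ R →
      |F (p, q) - F (p', q')| ≤ K * (|p - p'| + |q - q'|) := by
  obtain ⟨K, hK⟩ := ((hF.of_le (by norm_num)).locallyLipschitz (𝕂 := ℝ)).locallyLipschitzOn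
    |>.exists_lipschitzOnWith_of_compact (isCompact_closedBall (0 : ℝ × ℝ) R)
  refine ⟨K, fun p p' q q' hp hp' hq hq' => ?_⟩
  have h1 := hK.dist_le_mul _ (mem_closedBall_prod_zero_iff.2 ⟨hp, hq⟩) _
    (mem_closedBall_prod_zero_iff.2 ⟨hp', hq'⟩)
  rw [Real.dist_eq, dist_eq_norm, Prod.mk_sub_mk] at h1
  exact h1.trans (mul_le_mul_of_nonneg_left (norm_prod_le_abs_add _ _) K.2)

theorem ContDiff.exists_abs_fderiv_le_of_box {F : ℝ × ℝ → ℝ} (hF : ContDiff ℝ 2 F) (R : ℝ) :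
    ∃ M, 0 ≤ M ∧ ∀ p q, |p| ≤ R → |q| ≤ R →
      |fderiv ℝ F (p, q) (1, 0)| ≤ M ∧ |fderiv ℝ F (p, q) (0, 1)| ≤ M := by
  obtain ⟨M, hM⟩ := (isCompact_closedBall (0 : ℝ × ℝ) R).exists_bound_of_continuousOn
    (hF.continuous_fderiv (by norm_num)).continuousOn
  refine ⟨max M 0, le_max_right _ _, fun p q hp hq => ?_⟩
  have h1 := (hM _ (mem_closedBall_prod_zero_iff.2 ⟨hp, hq⟩)).trans (le_max_left M 0)
  constructor
  · refine ((fderiv ℝ F (p, q)).le_opNorm (1, 0)).trans ?_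
    simpa using h1
  · refine ((fderiv ℝ F (p, q)).le_opNorm (0, 1)).trans ?_
    simpa using h1

theorem ContDiff.exists_taylor_le_of_box {F : ℝ × ℝ → ℝ} (hF : ContDiff ℝ 2 F) (R : ℝ) :
    ∃ M, 0 ≤ M ∧ ∀ p p' q q', |p| ≤ R → |p'| ≤ R → |q| ≤ R → |q'| ≤ R →
      |F (p', q') - F (p, q) - gradApply F p q (p' - p) (q' - q)| ≤
        M * (|p' - p| + |q' - q|) ^ 2 := by
  have hF1 : ContDiff ℝ 1 (fderiv ℝ F) := hF.fderiv_right (by norm_num)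
  obtain ⟨K, hK⟩ := (hF1.locallyLipschitz (𝕂 := ℝ)).locallyLipschitzOn
    |>.exists_lipschitzOnWith_of_compact (isCompact_closedBall (0 : ℝ × ℝ) R)
  refine ⟨K, K.2, fun p p' q q' hp hp' hq hq' => ?_⟩
  have hz := mem_closedBall_prod_zero_iff.2 ⟨hp, hq⟩
  have hz' := mem_closedBall_prod_zero_iff.2 ⟨hp', hq'⟩
  have hsub : segment ℝ (p, q) (p', q') ⊆ Metric.closedBall (0 : ℝ × ℝ) R :=
    (convex_closedBall _ _).segment_subset hz hz'
  have h1 := (convex_segment (𝕜 := ℝ) (p, q) (p', q')).norm_image_sub_le_of_norm_fderiv_le' (f := F)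
    (φ := fderiv ℝ F (p, q)) (C := K * ‖(p', q') - (p, q)‖)
    (fun z _ => (hF.differentiable (by norm_num)) z) (fun z hzs => by
      have h2 := hK.dist_le_mul _ (hsub hzs) _ hz
      rw [dist_eq_norm, dist_eq_norm] at h2
      exact h2.trans (mul_le_mul_of_nonneg_left (norm_sub_le_of_mem_segment hzs) K.2))
    (left_mem_segment ℝ _ _) (right_mem_segment ℝ _ _)
  rw [Prod.mk_sub_mk, ← gradApply_eq, Real.norm_eq_abs, mul_assoc, ← sq] at h1
  refine h1.trans (mul_le_mul_of_nonneg_left ?_ K.2)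
  exact pow_le_pow_left₀ (norm_nonneg _) (norm_prod_le_abs_add _ _) 2

/-! ### The scheme as a monotone equation, and uniqueness -/

theorem isSchemeSolution_iff {F : ℝ × ℝ → ℝ} {u₀ : UnitAddCircle → ℝ} {h : ℝ}
    {u : UnitAddCircle → ℝ → ℝ} :
    IsSchemeSolution F u₀ h u ↔ IsSemidiscreteSolution (fun _ _ p q => F (p, q)) h u₀ u := by
  have e1 : ∀ v x, -torusDiffQuot h v x = stepDiff h h v x := fun v x => by
    simp only [torusDiffQuot, stepDiff]; ring
  have e2 : ∀ v x, torusDiffQuot (-h) v x = stepDiff (-h) h v x := fun v x => by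
    simp only [torusDiffQuot, stepDiff]; rw [div_neg, ← neg_div, neg_sub]
  constructor
  · rintro ⟨h1, h2, h3⟩
    exact ⟨h1, fun x t ht => by simpa only [e1, e2] using h2 x t ht, h3⟩
  · rintro ⟨h1, h2, h3⟩
    exact ⟨h1, fun x t ht => by simpa only [e1, e2] using h2 x t ht, h3⟩

theorem monotone_pair {F : ℝ × ℝ → ℝ} (hl : ∀ q : ℝ, Monotone fun p : ℝ => F (p, q))
    (hr : ∀ p : ℝ, Monotone fun q : ℝ => F (p, q)) {p p' q q' : ℝ} (hp : p ≤ p') (hq : q ≤ q') :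
    F (p, q) ≤ F (p', q') :=
  (hl q hp).trans (hr p' hq)

theorem IsSemidiscreteSolution.eq {Φ : UnitAddCircle → ℝ → ℝ → ℝ → ℝ} {h : ℝ} (hh : 0 < h)
    (hΦ : ∀ x t p p' q q', p ≤ p' → q ≤ q' → Φ x t p q ≤ Φ x t p' q') {v₀ : UnitAddCircle → ℝ}
    {v w : UnitAddCircle → ℝ → ℝ} (hv : IsSemidiscreteSolution Φ h v₀ v)
    (hw : IsSemidiscreteSolution Φ h v₀ w) (x : UnitAddCircle) (t : ℝ) (ht : 0 ≤ t) :
    v x t = w x t := by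
  have key : ∀ v w, IsSemidiscreteSolution Φ h v₀ v → IsSemidiscreteSolution Φ h v₀ w →
      v x t ≤ w x t := fun v w hv hw => by
    have := semidiscrete_comparison hh hΦ (T := t) (m := 0) (c := 0) (hv.continuousOn_Icc t)
      (hw.continuousOn_Icc t) (fun x s hs _ => hv.hasDerivAt x s hs)
      (fun x s hs _ => hw.hasDerivAt x s hs) (fun x => by rw [hv.initial, hw.initial, add_zero])
      (fun x s _ _ => by linarith) x t ht le_rfl
    linarith
  exact le_antisymm (key v w hv hw) (key w v hw hv)

section Gradient

variable {F : ℝ × ℝ → ℝ}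

theorem gradApply_sub (p q a b a' b' : ℝ) :
    gradApply F p q a b - gradApply F p q a' b' = gradApply F p q (a - a') (b - b') := by
  unfold gradApply; ring

theorem gradApply_mul (p q c a b : ℝ) :
    gradApply F p q (c * a) (c * b) = c * gradApply F p q a b := by
  unfold gradApply; ring

theorem abs_gradApply_le {p q M : ℝ} (h1 : |fderiv ℝ F (p, q) (1, 0)| ≤ M)
    (h2 : |fderiv ℝ F (p, q) (0, 1)| ≤ M) (a b : ℝ) : |gradApply F p q a b| ≤ M * (|a| + |b|) := by
  unfold gradApply
  refine (abs_add_le _ _).trans ?_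
  rw [abs_mul, abs_mul, mul_add]
  gcongr

theorem gradApply_mono (hF : Differentiable ℝ F) (hl : ∀ q : ℝ, Monotone fun p : ℝ => F (p, q))
    (hr : ∀ p : ℝ, Monotone fun q : ℝ => F (p, q)) (p q : ℝ) {a a' b b' : ℝ} (ha : a ≤ a')
    (hb : b ≤ b') : gradApply F p q a b ≤ gradApply F p q a' b' :=
  add_le_add (mul_le_mul_of_nonneg_left ha (fderiv_fst_nonneg_of_monotone hF hl _))
    (mul_le_mul_of_nonneg_left hb (fderiv_snd_nonneg_of_monotone hF hr _))

end Gradient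

/-! ### The linearized equation -/

/-- Freezing at time 0 extends the coefficients to negative times, because the existence theorem
asks for a nonlinearity continuous at all real times. -/
theorem continuous_max_zero {f : UnitAddCircle → ℝ → ℝ}
    (hf : ContinuousOn (fun y : UnitAddCircle × ℝ => f y.1 y.2) (univ ×ˢ Ici 0)) :
    Continuous fun y : UnitAddCircle × ℝ => f y.1 (max y.2 0) :=
  hf.comp_continuous (f := fun y : UnitAddCircle × ℝ => (y.1, max y.2 0)) (by fun_prop)
    fun y => ⟨mem_univ _, le_max_right y.2 0⟩

/-- Existence for the linearized equation
`v_t + DF(P, Q) · ((v(x) - v(x + h)) / h - f, (v(x) - v(x - h)) / h - g) = 0`. -/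
theorem exists_linearized {F : ℝ × ℝ → ℝ} (hF : ContDiff ℝ 2 F)
    (hl : ∀ q : ℝ, Monotone fun p : ℝ => F (p, q)) (hr : ∀ p : ℝ, Monotone fun q : ℝ => F (p, q))
    {P Q f g : UnitAddCircle → ℝ → ℝ}
    (hP : ContinuousOn (fun y : UnitAddCircle × ℝ => P y.1 y.2) (univ ×ˢ Ici 0))
    (hQ : ContinuousOn (fun y : UnitAddCircle × ℝ => Q y.1 y.2) (univ ×ˢ Ici 0))
    (hf : ContinuousOn (fun y : UnitAddCircle × ℝ => f y.1 y.2) (univ ×ˢ Ici 0))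
    (hg : ContinuousOn (fun y : UnitAddCircle × ℝ => g y.1 y.2) (univ ×ˢ Ici 0))
    {L : ℝ} (hPL : ∀ x t, 0 ≤ t → |P x t| ≤ L) (hQL : ∀ x t, 0 ≤ t → |Q x t| ≤ L)
    {h : ℝ} (hh : 0 < h) (v₀ : C(UnitAddCircle, ℝ)) :
    ∃ v, IsSemidiscreteSolution
      (fun x t p q => gradApply F (P x t) (Q x t) (p - f x t) (q - g x t)) h v₀ v := by
  have hd : Differentiable ℝ F := hF.differentiable (by norm_num)
  have hDF : Continuous (fderiv ℝ F) := hF.continuous_fderiv (by norm_num)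
  have hP' := continuous_max_zero hP
  have hQ' := continuous_max_zero hQ
  have hf' := continuous_max_zero hf
  have hg' := continuous_max_zero hg
  obtain ⟨v, hv⟩ := exists_isSemidiscreteSolution
    (Φ := fun x t p q => gradApply F (P x (max t 0)) (Q x (max t 0)) (p - f x (max t 0))
      (q - g x (max t 0))) (by
        have hπ : Continuous fun y : UnitAddCircle × ℝ × ℝ × ℝ => (y.1, y.2.1) := by fun_prop
        have h1 := hP'.comp hπ
        have h2 := hQ'.comp hπ
        have h3 := hf'.comp hπ
        have h4 := hg'.comp hπ
        simp only [Function.comp_def] at h1 h2 h3 h4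
        have h5 := hDF.comp (h1.prodMk h2)
        exact ((h5.clm_apply continuous_const).mul
          ((continuous_fst.comp (continuous_snd.comp continuous_snd)).sub h3)).add
          ((h5.clm_apply continuous_const).mul
          ((continuous_snd.comp (continuous_snd.comp continuous_snd)).sub h4)))
    (fun x t p p' q q' hp hq => gradApply_mono hd hl hr _ _ (by linarith) (by linarith))
    (fun T R => by
      obtain ⟨M, -, hM⟩ := hF.exists_abs_fderiv_le_of_box L
      refine ⟨M, fun x t p p' q q' _ _ _ _ _ => ?_⟩
      obtain ⟨h1, h2⟩ := hM _ _ (hPL x (max t 0) (le_max_right _ _)) (hQL x (max t 0) (le_max_right _ _))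
      rw [gradApply_sub, sub_sub_sub_cancel_right, sub_sub_sub_cancel_right]
      exact abs_gradApply_le h1 h2 _ _) hh v₀
  refine ⟨v, hv.continuousOn, fun x t ht => ?_, hv.initial⟩
  have := hv.hasDerivAt x t ht
  rwa [max_eq_left ht.le] at this

/-- Maximum principle for the linearized equation. -/
theorem linearized_le {F : ℝ × ℝ → ℝ} (hF : Differentiable ℝ F)
    (hl : ∀ q : ℝ, Monotone fun p : ℝ => F (p, q)) (hr : ∀ p : ℝ, Monotone fun q : ℝ => F (p, q))
    {P Q z z' : UnitAddCircle → ℝ → ℝ} {h T m c : ℝ} (hh : 0 < h)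
    (hz : ContinuousOn (fun y : UnitAddCircle × ℝ => z y.1 y.2) (univ ×ˢ Icc 0 T))
    (hd : ∀ x t, 0 < t → t ≤ T → HasDerivAt (z x) (z' x t) t)
    (h0 : ∀ x, z x 0 ≤ m)
    (hle : ∀ x t, 0 < t → t ≤ T → z' x t + gradApply F (P x t) (Q x t)
      (stepDiff h h (z · t) x) (stepDiff (-h) h (z · t) x) ≤ c)
    (x : UnitAddCircle) (t : ℝ) (ht : 0 ≤ t) (htT : t ≤ T) : z x t ≤ m + c * t := by
  refine le_add_mul_of_deriv_le_at_max hz hd h0 (fun x t h1 h2 h3 => ?_) x t ht htT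
  have h4 := gradApply_mono hF hl hr (P x t) (Q x t)
    (stepDiff_nonneg_of_forall_le (s := h) hh h3) (stepDiff_nonneg_of_forall_le (s := -h) hh h3)
  have h5 : gradApply F (P x t) (Q x t) 0 0 = 0 := by simp [gradApply]
  linarith [hle x t h1 h2]

theorem ContinuousOn.shift_torus {f : UnitAddCircle → ℝ → ℝ} {S : Set ℝ}
    (hf : ContinuousOn (fun y : UnitAddCircle × ℝ => f y.1 y.2) (univ ×ˢ S)) (a : UnitAddCircle) :
    ContinuousOn (fun y : UnitAddCircle × ℝ => f (y.1 + a) y.2) (univ ×ˢ S) :=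
  hf.comp (f := fun y : UnitAddCircle × ℝ => (y.1 + a, y.2)) (by fun_prop)
    fun _ hy => ⟨mem_univ _, hy.2⟩

theorem ContinuousOn.stepDiff_torus {f : UnitAddCircle → ℝ → ℝ} {S : Set ℝ}
    (hf : ContinuousOn (fun y : UnitAddCircle × ℝ => f y.1 y.2) (univ ×ˢ S)) (s h : ℝ) :
    ContinuousOn (fun y : UnitAddCircle × ℝ => stepDiff s h (f · y.2) y.1) (univ ×ˢ S) :=
  (hf.sub (hf.shift_torus _)).div_const h

/-! ### Lipschitz bounds, semiconcavity and the space derivative -/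

section Scheme

variable {F : ℝ × ℝ → ℝ} {u₀ : UnitAddCircle → ℝ} {h : ℝ} {u v : UnitAddCircle → ℝ → ℝ}

/-- The scheme preserves Lipschitz constants. -/
theorem IsSchemeSolution.abs_shift_sub_le
    (hl : ∀ q : ℝ, Monotone fun p : ℝ => F (p, q)) (hr : ∀ p : ℝ, Monotone fun q : ℝ => F (p, q))
    (hh : 0 < h) {L : ℝ}
    (hL : ∀ (x : UnitAddCircle) (y : ℝ), |u₀ (x + (y : UnitAddCircle)) - u₀ x| ≤ L * |y|)
    (hu : IsSchemeSolution F u₀ h u) (x : UnitAddCircle) (y t : ℝ) (ht : 0 ≤ t) :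
    |u (x + (y : UnitAddCircle)) t - u x t| ≤ L * |y| := by
  have key : ∀ (x : UnitAddCircle) (y : ℝ), u (x + (y : UnitAddCircle)) t - u x t ≤ L * |y| := by
    intro x y
    have hu' := isSchemeSolution_iff.1 hu
    have hc := hu'.continuousOn_Icc t
    have := semidiscrete_comparison (Φ := fun _ _ p q => F (p, q)) hh
      (fun _ _ p p' q q' => monotone_pair hl hr) (T := t) (m := L * |y|) (c := 0)
      (a := fun x s => u (x + (y : UnitAddCircle)) s) (hc.shift_torus _) hc
      (fun x s hs _ => hu'.hasDerivAt (x + (y : UnitAddCircle)) s hs)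
      (fun x s hs _ => hu'.hasDerivAt x s hs)
      (fun x => by
        rw [hu'.initial, hu'.initial]
        linarith [(abs_le.1 (hL x y)).2])
      (fun x s _ _ => by
        rw [stepDiff_shift (v := (u · s)), stepDiff_shift (v := (u · s))]
        linarith) x t ht le_rfl
    linarith
  refine abs_le.2 ⟨?_, key x y⟩
  have := key (x + (y : UnitAddCircle)) (-y)
  rw [AddCircle.coe_neg, add_neg_cancel_right, abs_neg] at this
  linarith

theorem abs_stepDiff_le_of_lipschitz {f : UnitAddCircle → ℝ} {L s : ℝ} (hh : 0 < h)
    (hs : |s| = h) (hf : ∀ (x : UnitAddCircle) (y : ℝ), |f (x + (y : UnitAddCircle)) - f x| ≤ L * |y|)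
    (x : UnitAddCircle) : |stepDiff s h f x| ≤ L := by
  rw [stepDiff, abs_div, abs_of_pos hh, div_le_iff₀ hh, abs_sub_comm, ← hs]
  exact hf x s

/-- The equation satisfied by the space derivative of a solution of the scheme. -/
abbrev IsSpaceDerivative (F : ℝ × ℝ → ℝ) (u₁ : UnitAddCircle → ℝ) (h : ℝ)
    (u v : UnitAddCircle → ℝ → ℝ) : Prop :=
  IsSemidiscreteSolution (fun x t p q => gradApply F (stepDiff h h (u · t) x)
    (stepDiff (-h) h (u · t) x) p q) h u₁ v

/-- The equation has no source, so the maximum principle applies to v and to -v. -/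
theorem IsSpaceDerivative.abs_le_of_initial (hF : Differentiable ℝ F)
    (hl : ∀ q : ℝ, Monotone fun p : ℝ => F (p, q)) (hr : ∀ p : ℝ, Monotone fun q : ℝ => F (p, q))
    (hh : 0 < h) {u₁ : UnitAddCircle → ℝ} {L : ℝ} (hL : ∀ x, |u₁ x| ≤ L)
    (hv : IsSpaceDerivative F u₁ h u v) (x : UnitAddCircle) (t : ℝ) (ht : 0 ≤ t) :
    |v x t| ≤ L := by
  have h1 := linearized_le hF hl hr (T := t) (m := L) (c := 0)
    (P := fun x t => stepDiff h h (u · t) x) (Q := fun x t => stepDiff (-h) h (u · t) x)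
    hh (hv.continuousOn_Icc t)
    (fun x s hs _ => hv.hasDerivAt x s hs)
    (fun x => by rw [hv.initial]; exact (abs_le.1 (hL x)).2)
    (fun x s _ _ => by linarith) x t ht le_rfl
  have h2 := linearized_le hF hl hr (T := t) (m := L) (c := 0)
    (P := fun x t => stepDiff h h (u · t) x) (Q := fun x t => stepDiff (-h) h (u · t) x)
    (z := fun x t => -1 * v x t) hh (continuousOn_const.mul (hv.continuousOn_Icc t))
    (fun x s hs _ => (hv.hasDerivAt x s hs).const_mul (-1))
    (fun x => by rw [hv.initial]; linarith [(abs_le.1 (hL x)).1])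
    (fun x s _ _ => by
      rw [stepDiff_const_mul, stepDiff_const_mul, gradApply_mul]
      linarith) x t ht le_rfl
  exact abs_le.2 ⟨by linarith, by linarith⟩

/-- Preservation of semiconcavity, in first-order form. -/
theorem IsSpaceDerivative.shift_le (hF : Differentiable ℝ F) (hconv : ConvexOn ℝ univ F)
    (hl : ∀ q : ℝ, Monotone fun p : ℝ => F (p, q)) (hr : ∀ p : ℝ, Monotone fun q : ℝ => F (p, q))
    (hh : 0 < h) {u₁ : UnitAddCircle → ℝ} {K : ℝ}
    (hK : ∀ (x : UnitAddCircle) (y : ℝ),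
      |u₀ (x + (y : UnitAddCircle)) - u₀ x - y * u₁ x| ≤ K * y ^ 2)
    (hu : IsSchemeSolution F u₀ h u) (hv : IsSpaceDerivative F u₁ h u v)
    (x : UnitAddCircle) (y t : ℝ) (ht : 0 ≤ t) :
    u (x + (y : UnitAddCircle)) t ≤ u x t + y * v x t + K * y ^ 2 := by
  have hu' := isSchemeSolution_iff.1 hu
  have hc := hu'.continuousOn_Icc t
  have := linearized_le hF hl hr (T := t) (m := K * y ^ 2) (c := 0)
    (P := fun x t => stepDiff h h (u · t) x) (Q := fun x t => stepDiff (-h) h (u · t) x)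
    (z := fun x t => u (x + (y : UnitAddCircle)) t - u x t - y * v x t)
    hh (((hc.shift_torus _).sub hc).sub (continuousOn_const.mul (hv.continuousOn_Icc t)))
    (fun x s hs _ => ((hu'.hasDerivAt (x + (y : UnitAddCircle)) s hs).sub
      (hu'.hasDerivAt x s hs)).sub ((hv.hasDerivAt x s hs).const_mul y))
    (fun x => by
      rw [hv.initial, hu.initial, hu.initial]
      exact (abs_le.1 (hK x y)).2)
    (fun x s _ _ => by
      have e : ∀ r, stepDiff r h (fun x => u (x + (y : UnitAddCircle)) s - u x s - y * v x s) x =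
          stepDiff r h (u · s) (x + (y : UnitAddCircle)) - stepDiff r h (u · s) x -
            y * stepDiff r h (v · s) x := fun r => by
        rw [stepDiff_sub, stepDiff_sub, stepDiff_const_mul, stepDiff_shift (v := (u · s))]
      rw [e, e, ← gradApply_sub, gradApply_mul]
      -- By convexity the remainder z is a subsolution of the equation linearized at x, so its
      -- initial bound K y² persists.
      have := hconv.add_gradApply_le hF (stepDiff h h (u · s) x) (stepDiff (-h) h (u · s) x)
        (stepDiff h h (u · s) (x + (y : UnitAddCircle)))
        (stepDiff (-h) h (u · s) (x + (y : UnitAddCircle)))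
      linarith) x t ht le_rfl
  linarith

/-- A solution of the scheme is differentiable in space, uniformly on bounded time intervals. -/
theorem IsSpaceDerivative.exists_abs_shift_sub_le (hF : ContDiff ℝ 2 F)
    (hl : ∀ q : ℝ, Monotone fun p : ℝ => F (p, q)) (hr : ∀ p : ℝ, Monotone fun q : ℝ => F (p, q))
    (hh : 0 < h) {u₁ : UnitAddCircle → ℝ} {L K : ℝ} (hL : ∀ x, |u₁ x| ≤ L)
    (hL' : ∀ (x : UnitAddCircle) (y : ℝ), |u₀ (x + (y : UnitAddCircle)) - u₀ x| ≤ L * |y|)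
    (hK : ∀ (x : UnitAddCircle) (y : ℝ),
      |u₀ (x + (y : UnitAddCircle)) - u₀ x - y * u₁ x| ≤ K * y ^ 2)
    (hu : IsSchemeSolution F u₀ h u) (hv : IsSpaceDerivative F u₁ h u v) (T : ℝ) :
    ∃ C, ∀ (x : UnitAddCircle) (y t : ℝ), |y| ≤ 1 → 0 ≤ t → t ≤ T →
      |u (x + (y : UnitAddCircle)) t - u x t - y * v x t| ≤ C * y ^ 2 := by
  have hd : Differentiable ℝ F := hF.differentiable (by norm_num)
  have hL0 : 0 ≤ L := (abs_nonneg _).trans (hL 0)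
  -- The quotients of u are at most L and those of v at most 2L/h; since |y| ≤ 1, those of u + y v
  -- stay in this box.
  obtain ⟨M, hM0, hM⟩ := hF.exists_taylor_le_of_box (L + 2 * L / h)
  refine ⟨K + M * (4 * L / h) ^ 2 * T, fun x y t hy ht htT => ?_⟩
  have hu' := isSchemeSolution_iff.1 hu
  have hc := hu'.continuousOn_Icc t
  have hcb : ContinuousOn (fun z : UnitAddCircle × ℝ => u z.1 z.2 + y * v z.1 z.2)
      (univ ×ˢ Icc 0 t) := hc.add (continuousOn_const.mul (hv.continuousOn_Icc t))
  have hres : ∀ x s, 0 < s → |F (stepDiff h h (fun x => u x s + y * v x s) x,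
      stepDiff (-h) h (fun x => u x s + y * v x s) x) -
      F (stepDiff h h (u · s) x, stepDiff (-h) h (u · s) x) -
      y * gradApply F (stepDiff h h (u · s) x) (stepDiff (-h) h (u · s) x)
        (stepDiff h h (v · s) x) (stepDiff (-h) h (v · s) x)| ≤ M * (4 * L / h) ^ 2 * y ^ 2 := by
    intro x s hs
    have hlip := fun x y => hu.abs_shift_sub_le hl hr hh hL' x y s hs.le
    have p1 : |stepDiff h h (u · s) x| ≤ L :=
      abs_stepDiff_le_of_lipschitz hh (abs_of_pos hh) hlip x
    have q1 : |stepDiff (-h) h (u · s) x| ≤ L :=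
      abs_stepDiff_le_of_lipschitz hh (by rw [abs_neg, abs_of_pos hh]) hlip x
    have hvb : ∀ x, |v x s| ≤ L := fun x => hv.abs_le_of_initial hd hl hr hh hL x s hs.le
    have p2 : |stepDiff h h (v · s) x| ≤ 2 * L / h := abs_stepDiff_le_of_abs_le hh hvb x
    have q2 : |stepDiff (-h) h (v · s) x| ≤ 2 * L / h := abs_stepDiff_le_of_abs_le hh hvb x
    have hnn : 0 ≤ 2 * L / h := by positivity
    have hyp : ∀ a, |a| ≤ 2 * L / h → |y * a| ≤ 2 * L / h * |y| := fun a ha => by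
      rw [abs_mul, mul_comm]
      exact mul_le_mul_of_nonneg_right ha (abs_nonneg y)
    have hyp' : ∀ a, |a| ≤ 2 * L / h → |y * a| ≤ 2 * L / h := fun a ha =>
      (hyp a ha).trans (mul_le_of_le_one_right hnn hy)
    rw [stepDiff_add, stepDiff_add, stepDiff_const_mul, stepDiff_const_mul, ← gradApply_mul]
    have := hM _ (stepDiff h h (u · s) x + y * stepDiff h h (v · s) x) _
      (stepDiff (-h) h (u · s) x + y * stepDiff (-h) h (v · s) x) (p1.trans (by linarith))
      ((abs_add_le _ _).trans (add_le_add p1 (hyp' _ p2))) (q1.trans (by linarith))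
      ((abs_add_le _ _).trans (add_le_add q1 (hyp' _ q2)))
    rw [add_sub_cancel_left, add_sub_cancel_left] at this
    refine this.trans ?_
    rw [mul_assoc, ← sq_abs y, ← mul_pow]
    refine mul_le_mul_of_nonneg_left (pow_le_pow_left₀ (by positivity) ?_ 2) hM0
    calc _ ≤ _ := add_le_add (hyp _ p2) (hyp _ q2)
      _ = 4 * L / h * |y| := by ring
  have h1 := semidiscrete_comparison (Φ := fun _ _ p q => F (p, q)) hh
    (fun _ _ p p' q q' => monotone_pair hl hr) (T := t) (m := K * y ^ 2)
    (c := M * (4 * L / h) ^ 2 * y ^ 2)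
    (a := fun x s => u (x + (y : UnitAddCircle)) s) (b := fun x s => u x s + y * v x s)
    (hc.shift_torus _) hcb
    (fun x s hs _ => hu'.hasDerivAt (x + (y : UnitAddCircle)) s hs)
    (fun x s hs _ => (hu'.hasDerivAt x s hs).add ((hv.hasDerivAt x s hs).const_mul y))
    (fun x => by
      rw [hu.initial, hu.initial, hv.initial]
      linarith [(abs_le.1 (hK x y)).2])
    (fun x s hs _ => by
      rw [stepDiff_shift (v := (u · s)), stepDiff_shift (v := (u · s))]
      linarith [(abs_le.1 (hres x s hs)).1]) x t ht le_rfl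
  have h2 := semidiscrete_comparison (Φ := fun _ _ p q => F (p, q)) hh
    (fun _ _ p p' q q' => monotone_pair hl hr) (T := t) (m := K * y ^ 2)
    (c := M * (4 * L / h) ^ 2 * y ^ 2)
    (b := fun x s => u (x + (y : UnitAddCircle)) s) (a := fun x s => u x s + y * v x s)
    hcb (hc.shift_torus _)
    (fun x s hs _ => (hu'.hasDerivAt x s hs).add ((hv.hasDerivAt x s hs).const_mul y))
    (fun x s hs _ => hu'.hasDerivAt (x + (y : UnitAddCircle)) s hs)
    (fun x => by
      rw [hu.initial, hu.initial, hv.initial]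
      linarith [(abs_le.1 (hK x y)).1])
    (fun x s hs _ => by
      rw [stepDiff_shift (v := (u · s)), stepDiff_shift (v := (u · s))]
      linarith [(abs_le.1 (hres x s hs)).2]) x t ht le_rfl
  have h3 : M * (4 * L / h) ^ 2 * y ^ 2 * t ≤ M * (4 * L / h) ^ 2 * y ^ 2 * T :=
    mul_le_mul_of_nonneg_left htT (by positivity)
  exact abs_le.2 ⟨by linarith, by linarith⟩

end Scheme

/-! ### The source term of the step derivative -/

/-- Minus the derivative in `h` of the quotient `stepDiff s h U x` for `s = ±h`, when `v` is the
space derivative of `U`. -/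
noncomputable def stepSource (s h : ℝ) (U v : UnitAddCircle → ℝ) (x : UnitAddCircle) : ℝ :=
  (U x - U (x + (s : UnitAddCircle)) + s * v (x + (s : UnitAddCircle))) / h ^ 2

/-- The error is an exact fraction: a Taylor remainder of U at x + σh, an increment of w there, and
ε² times the linear term, all over h + ε. The sign σ treats both directions at once. -/
theorem abs_stepDiff_expansion_le {U v w : UnitAddCircle → ℝ} {h ε σ C η B : ℝ}
    {x : UnitAddCircle} (hσ : σ = 1 ∨ σ = -1) (hh : 0 < h) (hk : 0 < h + ε)
    (hU : ∀ (z : UnitAddCircle) (y : ℝ), |y| = |ε| →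
      |U (z + (y : UnitAddCircle)) - U z - y * v z| ≤ C * ε ^ 2)
    (hw : ∀ (z : UnitAddCircle) (y : ℝ), |y| = |ε| → |w (z + (y : UnitAddCircle)) - w z| ≤ η)
    (hB : |stepDiff (σ * h) h w x - stepSource (σ * h) h U v x| ≤ B) :
    |stepDiff (σ * (h + ε)) (h + ε) (fun y => U y + ε * w y) x - stepDiff (σ * h) h U x -
      ε * (stepDiff (σ * h) h w x - stepSource (σ * h) h U v x)| ≤
      (C * ε ^ 2 + η * |ε| + B * ε ^ 2) / (h + ε) := by
  set p := stepDiff (σ * h) h w x - stepSource (σ * h) h U v x with hp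
  set z : UnitAddCircle := x + ((σ * h : ℝ) : UnitAddCircle) with hz
  have hσε : |σ * ε| = |ε| := by rcases hσ with rfl | rfl <;> simp
  have hxz : x + ((σ * (h + ε) : ℝ) : UnitAddCircle) = z + ((σ * ε : ℝ) : UnitAddCircle) := by
    rw [hz, add_assoc, ← AddCircle.coe_add, mul_add]
  have e : stepDiff (σ * (h + ε)) (h + ε) (fun y => U y + ε * w y) x - stepDiff (σ * h) h U x -
      ε * p = -((U (z + ((σ * ε : ℝ) : UnitAddCircle)) - U z - σ * ε * v z) +
        ε * (w (z + ((σ * ε : ℝ) : UnitAddCircle)) - w z) + ε ^ 2 * p) / (h + ε) := by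
    rw [eq_div_iff hk.ne', hp]
    unfold stepDiff stepSource
    rw [hxz, ← hz]
    field_simp
    ring
  rw [e, abs_div, abs_of_pos hk, abs_neg]
  gcongr
  refine (abs_add_le _ _).trans (add_le_add ((abs_add_le _ _).trans (add_le_add (hU z _ hσε) ?_)) ?_)
  · rw [abs_mul, mul_comm]
    exact mul_le_mul_of_nonneg_right (hw z _ hσε) (abs_nonneg _)
  · rw [abs_mul, abs_of_nonneg (sq_nonneg ε), mul_comm]
    exact mul_le_mul_of_nonneg_right hB (sq_nonneg _)

theorem abs_stepSource_le {U v : UnitAddCircle → ℝ} {s h L : ℝ} (hh : 0 < h) (hs : |s| = h)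
    (hU : ∀ (x : UnitAddCircle) (y : ℝ), |U (x + (y : UnitAddCircle)) - U x| ≤ L * |y|)
    (hv : ∀ x, |v x| ≤ L) (x : UnitAddCircle) : |stepSource s h U v x| ≤ 2 * L / h := by
  rw [stepSource, abs_div, abs_of_pos (by positivity : 0 < h ^ 2),
    div_le_div_iff₀ (by positivity) hh]
  have h1 := hU x s
  have h2 : |s * v (x + (s : UnitAddCircle))| ≤ h * L := by
    rw [abs_mul, hs]
    exact mul_le_mul_of_nonneg_left (hv _) hh.le
  rw [hs, abs_sub_comm] at h1
  have h3 := (abs_add_le (U x - U (x + (s : UnitAddCircle))) (s * v (x + (s : UnitAddCircle)))).trans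
    (add_le_add h1 h2)
  calc _ ≤ (L * h + h * L) * h := mul_le_mul_of_nonneg_right h3 hh.le
    _ = _ := by ring

/-- Semiconcavity is used at the base point x + s with increment -s. -/
theorem stepSource_le {U v : UnitAddCircle → ℝ} {s h K : ℝ} (hh : 0 < h) (hs : |s| = h)
    (hU : ∀ (x : UnitAddCircle) (y : ℝ), U (x + (y : UnitAddCircle)) ≤ U x + y * v x + K * y ^ 2)
    (x : UnitAddCircle) : stepSource s h U v x ≤ K := by
  rw [stepSource, div_le_iff₀ (by positivity)]
  have h1 := hU (x + (s : UnitAddCircle)) (-s)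
  rw [AddCircle.coe_neg, add_neg_cancel_right] at h1
  have h2 : s ^ 2 = h ^ 2 := by rw [← hs, sq_abs]
  rw [neg_sq, h2] at h1
  linarith

/-- Here the base point is x with increment s; replacing v(x) by v(x + s) costs one quotient of v.
-/
theorem le_stepSource {U v : UnitAddCircle → ℝ} {s h K : ℝ} (hh : 0 < h) (hs : |s| = h)
    (hU : ∀ (x : UnitAddCircle) (y : ℝ), U (x + (y : UnitAddCircle)) ≤ U x + y * v x + K * y ^ 2)
    (x : UnitAddCircle) : -|stepDiff s h v x| - K ≤ stepSource s h U v x := by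
  have h1 := hU x s
  have h2 : s ^ 2 = h ^ 2 := by rw [← hs, sq_abs]
  have h3 : -|stepDiff s h v x| ≤ s * (v (x + (s : UnitAddCircle)) - v x) / h ^ 2 := by
    have : |s * (v (x + (s : UnitAddCircle)) - v x) / h ^ 2| = |stepDiff s h v x| := by
      rw [stepDiff, abs_div, abs_div, abs_mul, hs, abs_sub_comm, abs_of_pos hh,
        abs_of_pos (by positivity : 0 < h ^ 2)]
      field_simp
    rw [← this]
    exact neg_abs_le _
  have h4 : s * (v (x + (s : UnitAddCircle)) - v x) / h ^ 2 - K ≤ stepSource s h U v x := by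
    rw [stepSource, sub_le_iff_le_add, ← sub_le_iff_le_add', ← sub_div, div_le_iff₀ (by positivity)]
    rw [h2] at h1
    linarith
  linarith

/-- The equation satisfied by the derivative of the scheme solution with respect to the step. -/
abbrev IsStepDerivative (F : ℝ × ℝ → ℝ) (h : ℝ) (u v w : UnitAddCircle → ℝ → ℝ) : Prop :=
  IsSemidiscreteSolution (fun x t p q => gradApply F (stepDiff h h (u · t) x)
    (stepDiff (-h) h (u · t) x) (p - stepSource h h (u · t) (v · t) x)
    (q - stepSource (-h) h (u · t) (v · t) x)) h (fun _ => 0) w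

theorem ContinuousOn.stepSource_torus {f g : UnitAddCircle → ℝ → ℝ} {S : Set ℝ}
    (hf : ContinuousOn (fun y : UnitAddCircle × ℝ => f y.1 y.2) (univ ×ˢ S))
    (hg : ContinuousOn (fun y : UnitAddCircle × ℝ => g y.1 y.2) (univ ×ˢ S)) (s h : ℝ) :
    ContinuousOn (fun y : UnitAddCircle × ℝ => stepSource s h (f · y.2) (g · y.2) y.1)
      (univ ×ˢ S) :=
  ((hf.sub (hf.shift_torus _)).add (continuousOn_const.mul (hg.shift_torus _))).div_const (h ^ 2)

theorem exists_modulus_torus {w : UnitAddCircle → ℝ → ℝ} {T : ℝ}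
    (hw : ContinuousOn (fun y : UnitAddCircle × ℝ => w y.1 y.2) (univ ×ˢ Icc 0 T)) {η : ℝ}
    (hη : 0 < η) : ∃ δ > 0, ∀ (x : UnitAddCircle) (y t : ℝ), |y| ≤ δ → t ∈ Icc 0 T →
      |w (x + (y : UnitAddCircle)) t - w x t| ≤ η := by
  have huc := (isCompact_univ.prod isCompact_Icc).uniformContinuousOn_of_continuous hw
  obtain ⟨δ, hδ, H⟩ := Metric.uniformContinuousOn_iff.1 huc η hη
  refine ⟨δ / 2, by positivity, fun x y t hy ht => ?_⟩
  have hdist : dist (x + (y : UnitAddCircle), t) (x, t) < δ := by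
    rw [Prod.dist_eq, dist_self, max_eq_left dist_nonneg, dist_self_add_left]
    have : ‖(y : UnitAddCircle)‖ ≤ |y| := QuotientAddGroup.norm_mk_le_norm
    linarith
  exact (H _ ⟨mem_univ _, ht⟩ _ ⟨mem_univ _, ht⟩ hdist).le

/-! ### Differentiability in the step -/

section Step

variable {F : ℝ × ℝ → ℝ} {u₀ : UnitAddCircle → ℝ} {h : ℝ} {u v w : UnitAddCircle → ℝ → ℝ}

/-- First-order expansion of the scheme solution in the step, uniformly in space. -/
theorem IsStepDerivative.abs_sub_le (hF : ContDiff ℝ 2 F)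
    (hl : ∀ q : ℝ, Monotone fun p : ℝ => F (p, q)) (hr : ∀ p : ℝ, Monotone fun q : ℝ => F (p, q))
    (hh : 0 < h) {u₁ : UnitAddCircle → ℝ} {L K : ℝ} (hL : ∀ x, |u₁ x| ≤ L)
    (hL' : ∀ (x : UnitAddCircle) (y : ℝ), |u₀ (x + (y : UnitAddCircle)) - u₀ x| ≤ L * |y|)
    (hK : ∀ (x : UnitAddCircle) (y : ℝ),
      |u₀ (x + (y : UnitAddCircle)) - u₀ x - y * u₁ x| ≤ K * y ^ 2)
    (hu : IsSchemeSolution F u₀ h u) (hv : IsSpaceDerivative F u₁ h u v)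
    (hw : IsStepDerivative F h u v w) {t : ℝ} (ht : 0 < t) {r : ℝ} (hr0 : 0 < r) :
    ∃ δ > 0, ∀ ε, |ε| ≤ δ → ∀ V, IsSchemeSolution F u₀ (h + ε) V →
      ∀ x, |V x t - u x t - ε * w x t| ≤ r * |ε| := by
  have hd : Differentiable ℝ F := hF.differentiable (by norm_num)
  have hL0 : 0 ≤ L := (abs_nonneg _).trans (hL 0)
  have hu' := isSchemeSolution_iff.1 hu
  obtain ⟨C, hC⟩ := hv.exists_abs_shift_sub_le hF hl hr hh hL hL' hK hu t
  obtain ⟨W, hW⟩ := (isCompact_univ.prod isCompact_Icc).exists_bound_of_continuousOn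
    (hw.continuousOn_Icc t)
  have hWb : ∀ s ∈ Icc 0 t, ∀ x, |w x s| ≤ W := fun s hs x => hW (x, s) ⟨mem_univ _, hs⟩
  have hW0 : 0 ≤ W := (abs_nonneg _).trans (hWb t ⟨ht.le, le_rfl⟩ 0)
  set B : ℝ := 2 * W / h + 2 * L / h with hB
  have hB0 : 0 ≤ B := by positivity
  obtain ⟨M, hM0, hM⟩ := hF.exists_abs_fderiv_le_of_box L
  obtain ⟨N, hN0, hN⟩ := hF.exists_taylor_le_of_box (L + B + 1)
  -- `κ` bounds the relative error of the quotients
  obtain ⟨κ, hκ0, hκ1, hκr⟩ : ∃ κ : ℝ, 0 < κ ∧ κ ≤ 1 ∧ 2 * M * κ * t ≤ r / 2 := by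
    refine ⟨min 1 (r / (4 * (M + 1) * t)), by positivity, min_le_left _ _, ?_⟩
    calc 2 * M * min 1 (r / (4 * (M + 1) * t)) * t
        ≤ 2 * (M + 1) * (r / (4 * (M + 1) * t)) * t := by
          gcongr
          · linarith
          · exact min_le_right _ _
      _ = r / 2 := by field_simp; norm_num
  obtain ⟨δ₁, hδ₁, hmod⟩ := exists_modulus_torus (hw.continuousOn_Icc t)
    (η := κ * h / 8) (by positivity)
  -- Since h + ε ≥ h/2, these conditions bound each quotient error by κ|ε|; the last one gives the
  -- quadratic remainder of F half of the budget r|ε|.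
  obtain ⟨δ, hδ0, hδ1, hδh, hδδ₁, hδκ, hδr⟩ : ∃ δ > 0, δ ≤ 1 ∧ δ ≤ h / 2 ∧ δ ≤ δ₁ ∧
      (|C| + B) * δ ≤ κ * h / 8 ∧ N * (2 * (B + 1)) ^ 2 * δ * t ≤ r / 2 := by
    refine ⟨min (min 1 (h / 2)) (min δ₁ (min (κ * h / 8 / (|C| + B + 1))
      (r / 2 / ((N * (2 * (B + 1)) ^ 2 + 1) * t)))), by positivity,
      (min_le_left _ _).trans (min_le_left _ _), (min_le_left _ _).trans (min_le_right _ _),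
      (min_le_right _ _).trans (min_le_left _ _), ?_, ?_⟩
    · calc _ ≤ (|C| + B + 1) * (κ * h / 8 / (|C| + B + 1)) := by
            refine mul_le_mul (by linarith) ?_ (by positivity) (by positivity)
            exact min_le_of_right_le (min_le_of_right_le (min_le_left _ _))
        _ = κ * h / 8 := by field_simp
    · calc _ ≤ (N * (2 * (B + 1)) ^ 2 + 1) * (r / 2 / ((N * (2 * (B + 1)) ^ 2 + 1) * t)) * t := by
            gcongr
            · linarith
            · exact min_le_of_right_le (min_le_of_right_le (min_le_right _ _))
        _ = r / 2 := by field_simp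
  refine ⟨δ, hδ0, fun ε hε V hV => ?_⟩
  have hV' := isSchemeSolution_iff.1 hV
  have hk2 : h / 2 ≤ h + ε := by linarith [(abs_le.1 hε).1]
  have hk : 0 < h + ε := by linarith
  have herr : (C * ε ^ 2 + κ * h / 8 * |ε| + B * ε ^ 2) / (h + ε) ≤ κ * |ε| := by
    rw [div_le_iff₀ hk]
    have h1 : (C + B) * |ε| ≤ κ * h / 8 :=
      le_trans (mul_le_mul (add_le_add_left (le_abs_self C) B) hε (abs_nonneg _) (by positivity)) hδκ
    have h2 : κ * |ε| * (h / 2) ≤ κ * |ε| * (h + ε) := mul_le_mul_of_nonneg_left hk2 (by positivity)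
    have h3 := mul_le_mul_of_nonneg_right h1 (abs_nonneg ε)
    rw [← sq_abs ε]
    nlinarith [mul_nonneg (mul_nonneg hκ0.le hh.le) (abs_nonneg ε)]
  set c : ℝ := N * (2 * (B + 1)) ^ 2 * δ * |ε| + 2 * M * κ * |ε| with hc
  -- This is the residual of u + ε w in the scheme with step h + ε.
  have hres : ∀ x s, 0 < s → s ≤ t →
      |F (stepDiff (h + ε) (h + ε) (fun x => u x s + ε * w x s) x,
        stepDiff (-(h + ε)) (h + ε) (fun x => u x s + ε * w x s) x) -
      F (stepDiff h h (u · s) x, stepDiff (-h) h (u · s) x) -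
      ε * gradApply F (stepDiff h h (u · s) x) (stepDiff (-h) h (u · s) x)
        (stepDiff h h (w · s) x - stepSource h h (u · s) (v · s) x)
        (stepDiff (-h) h (w · s) x - stepSource (-h) h (u · s) (v · s) x)| ≤ c := by
    intro x s hs hst
    have hlip := fun x y => hu.abs_shift_sub_le hl hr hh hL' x y s hs.le
    have hvb : ∀ x, |v x s| ≤ L := fun x => hv.abs_le_of_initial hd hl hr hh hL x s hs.le
    have hh1 : |h| = h := abs_of_pos hh
    have hh2 : |-h| = h := by rw [abs_neg, hh1]
    set P := stepDiff h h (u · s) x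
    set Q := stepDiff (-h) h (u · s) x
    set p := stepDiff h h (w · s) x - stepSource h h (u · s) (v · s) x
    set q := stepDiff (-h) h (w · s) x - stepSource (-h) h (u · s) (v · s) x
    set P' := stepDiff (h + ε) (h + ε) (fun x => u x s + ε * w x s) x
    set Q' := stepDiff (-(h + ε)) (h + ε) (fun x => u x s + ε * w x s) x
    have hP : |P| ≤ L := abs_stepDiff_le_of_lipschitz hh hh1 hlip x
    have hQ : |Q| ≤ L := abs_stepDiff_le_of_lipschitz hh hh2 hlip x
    have hp : |p| ≤ B := (abs_sub _ _).trans (add_le_add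
      (abs_stepDiff_le_of_abs_le hh (hWb s ⟨hs.le, hst⟩) x) (abs_stepSource_le hh hh1 hlip hvb x))
    have hq : |q| ≤ B := (abs_sub _ _).trans (add_le_add
      (abs_stepDiff_le_of_abs_le hh (hWb s ⟨hs.le, hst⟩) x) (abs_stepSource_le hh hh2 hlip hvb x))
    have hexp : ∀ σ : ℝ, σ = 1 ∨ σ = -1 →
        |stepDiff (σ * h) h (w · s) x - stepSource (σ * h) h (u · s) (v · s) x| ≤ B →
        |stepDiff (σ * (h + ε)) (h + ε) (fun y => u y s + ε * w y s) x -
          stepDiff (σ * h) h (u · s) x - ε * (stepDiff (σ * h) h (w · s) x -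
            stepSource (σ * h) h (u · s) (v · s) x)| ≤ κ * |ε| := fun σ hσ hσB =>
      (abs_stepDiff_expansion_le hσ hh hk
        (fun z y hy => by
          rw [← sq_abs ε, ← hy, sq_abs]
          exact hC z y s (by rw [hy]; exact hε.trans hδ1) hs.le hst)
        (fun z y hy => hmod z y s (by rw [hy]; exact hε.trans hδδ₁) ⟨hs.le, hst⟩) hσB).trans herr
    have hP' : |P' - P - ε * p| ≤ κ * |ε| := by
      have := hexp 1 (Or.inl rfl)
      simp only [one_mul] at this
      exact this hp
    have hQ' : |Q' - Q - ε * q| ≤ κ * |ε| := by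
      have := hexp (-1) (Or.inr rfl)
      simp only [neg_one_mul] at this
      exact this hq
    have hstep : ∀ P' P p : ℝ, |p| ≤ B → |P' - P - ε * p| ≤ κ * |ε| →
        |P' - P| ≤ (B + 1) * |ε| := fun P' P p hp hP => by
      have h1 := abs_sub_abs_le_abs_sub (P' - P) (ε * p)
      have h2 : |ε * p| ≤ B * |ε| := by
        rw [abs_mul, mul_comm]
        exact mul_le_mul_of_nonneg_right hp (abs_nonneg _)
      have h3 : κ * |ε| ≤ 1 * |ε| := mul_le_mul_of_nonneg_right hκ1 (abs_nonneg _)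
      linarith
    have hPP := hstep _ _ _ hp hP'
    have hQQ := hstep _ _ _ hq hQ'
    have hε1 : (B + 1) * |ε| ≤ B + 1 := mul_le_of_le_one_right (by positivity) (hε.trans hδ1)
    have hbox : ∀ P' P : ℝ, |P| ≤ L → |P' - P| ≤ (B + 1) * |ε| → |P'| ≤ L + B + 1 :=
      fun P' P h1 h2 => by linarith [abs_sub_abs_le_abs_sub P' P]
    have hT := hN P P' Q Q' (hP.trans (by linarith)) (hbox _ _ hP hPP) (hQ.trans (by linarith))
      (hbox _ _ hQ hQQ)
    have hG := abs_gradApply_le (hM P Q hP hQ).1 (hM P Q hP hQ).2 (P' - P - ε * p) (Q' - Q - ε * q)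
    rw [← gradApply_sub, gradApply_mul] at hG
    have hG' : M * (|P' - P - ε * p| + |Q' - Q - ε * q|) ≤ 2 * M * κ * |ε| := by
      calc _ ≤ M * (κ * |ε| + κ * |ε|) := by gcongr
        _ = _ := by ring
    have hT' : N * (|P' - P| + |Q' - Q|) ^ 2 ≤ N * (2 * (B + 1)) ^ 2 * δ * |ε| := by
      calc _ ≤ N * ((B + 1) * |ε| + (B + 1) * |ε|) ^ 2 := by gcongr
        _ = N * (2 * (B + 1)) ^ 2 * |ε| * |ε| := by ring
        _ ≤ _ := by gcongr
    have e : F (P', Q') - F (P, Q) - ε * gradApply F P Q p q =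
        (F (P', Q') - F (P, Q) - gradApply F P Q (P' - P) (Q' - Q)) +
        (gradApply F P Q (P' - P) (Q' - Q) - ε * gradApply F P Q p q) := by ring
    rw [e]
    exact (abs_add_le _ _).trans (add_le_add (hT.trans hT') (hG.trans hG'))
  have hcu : ContinuousOn (fun z : UnitAddCircle × ℝ => u z.1 z.2 + ε * w z.1 z.2)
      (univ ×ˢ Icc 0 t) :=
    (hu'.continuousOn_Icc t).add (continuousOn_const.mul (hw.continuousOn_Icc t))
  have hct : c * t ≤ r * |ε| := by
    have h1 := mul_le_mul_of_nonneg_right (add_le_add hδr hκr) (abs_nonneg ε)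
    calc c * t = (N * (2 * (B + 1)) ^ 2 * δ * t + 2 * M * κ * t) * |ε| := by rw [hc]; ring
      _ ≤ (r / 2 + r / 2) * |ε| := h1
      _ = _ := by ring
  intro x
  have h1 := semidiscrete_comparison (Φ := fun _ _ p q => F (p, q)) hk
    (fun _ _ p p' q q' => monotone_pair hl hr) (T := t) (m := 0) (c := c)
    (a := V) (b := fun x s => u x s + ε * w x s) (hV'.continuousOn_Icc t) hcu
    (fun x s hs _ => hV'.hasDerivAt x s hs)
    (fun x s hs _ => (hu'.hasDerivAt x s hs).add ((hw.hasDerivAt x s hs).const_mul ε))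
    (fun x => by rw [hu.initial, hV.initial, hw.initial]; linarith)
    (fun x s hs hst => by linarith [(abs_le.1 (hres x s hs hst)).1]) x t ht.le le_rfl
  have h2 := semidiscrete_comparison (Φ := fun _ _ p q => F (p, q)) hk
    (fun _ _ p p' q q' => monotone_pair hl hr) (T := t) (m := 0) (c := c)
    (b := V) (a := fun x s => u x s + ε * w x s) hcu (hV'.continuousOn_Icc t)
    (fun x s hs _ => (hu'.hasDerivAt x s hs).add ((hw.hasDerivAt x s hs).const_mul ε))
    (fun x s hs _ => hV'.hasDerivAt x s hs)
    (fun x => by rw [hu.initial, hV.initial, hw.initial]; linarith)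
    (fun x s hs hst => by linarith [(abs_le.1 (hres x s hs hst)).2]) x t ht.le le_rfl
  exact abs_le.2 ⟨by linarith, by linarith⟩

end Step

/-! ### Bounds for the step derivative -/

section Bounds

variable {F : ℝ × ℝ → ℝ} {u₀ : UnitAddCircle → ℝ} {h : ℝ} {u v w : UnitAddCircle → ℝ → ℝ}

/-- A bound on the source term of the equation for the step derivative bounds its growth. -/
theorem IsStepDerivative.le_mul (hF : Differentiable ℝ F)
    (hl : ∀ q : ℝ, Monotone fun p : ℝ => F (p, q)) (hr : ∀ p : ℝ, Monotone fun q : ℝ => F (p, q))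
    (hh : 0 < h) (hw : IsStepDerivative F h u v w) {c : ℝ}
    (hc : ∀ x t, 0 < t → gradApply F (stepDiff h h (u · t) x) (stepDiff (-h) h (u · t) x)
      (stepSource h h (u · t) (v · t) x) (stepSource (-h) h (u · t) (v · t) x) ≤ c)
    (x : UnitAddCircle) (t : ℝ) (ht : 0 ≤ t) : w x t ≤ c * t := by
  have := linearized_le hF hl hr (T := t) (m := 0) (c := c)
    (P := fun x t => stepDiff h h (u · t) x) (Q := fun x t => stepDiff (-h) h (u · t) x)
    hh (hw.continuousOn_Icc t) (fun x s hs _ => hw.hasDerivAt x s hs)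
    (fun x => by rw [hw.initial])
    (fun x s hs _ => by
      rw [← gradApply_sub]
      linarith [hc x s hs]) x t ht le_rfl
  linarith

theorem IsStepDerivative.neg_mul_le (hF : Differentiable ℝ F)
    (hl : ∀ q : ℝ, Monotone fun p : ℝ => F (p, q)) (hr : ∀ p : ℝ, Monotone fun q : ℝ => F (p, q))
    (hh : 0 < h) (hw : IsStepDerivative F h u v w) {c : ℝ}
    (hc : ∀ x t, 0 < t → -c ≤ gradApply F (stepDiff h h (u · t) x) (stepDiff (-h) h (u · t) x)
      (stepSource h h (u · t) (v · t) x) (stepSource (-h) h (u · t) (v · t) x))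
    (x : UnitAddCircle) (t : ℝ) (ht : 0 ≤ t) : -(c * t) ≤ w x t := by
  have := linearized_le hF hl hr (T := t) (m := 0) (c := c)
    (P := fun x t => stepDiff h h (u · t) x) (Q := fun x t => stepDiff (-h) h (u · t) x)
    (z := fun x t => -1 * w x t)
    hh (continuousOn_const.mul (hw.continuousOn_Icc t))
    (fun x s hs _ => (hw.hasDerivAt x s hs).const_mul (-1))
    (fun x => by rw [hw.initial, mul_zero])
    (fun x s hs _ => by
      rw [stepDiff_const_mul, stepDiff_const_mul, gradApply_mul, ← gradApply_sub]
      linarith [hc x s hs]) x t ht le_rfl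
  linarith

/-- The lower bound of order `1 / √h`: the dissipation in the equation for `v ^ 2` absorbs the
source term. -/
theorem IsStepDerivative.neg_le_of_semiconcave (hF : Differentiable ℝ F)
    (hl : ∀ q : ℝ, Monotone fun p : ℝ => F (p, q)) (hr : ∀ p : ℝ, Monotone fun q : ℝ => F (p, q))
    (hh : 0 < h) {u₁ : UnitAddCircle → ℝ} {L K M : ℝ} (hK : 0 ≤ K) (hL : ∀ x, |u₁ x| ≤ L)
    (hM : ∀ x t, 0 < t →
      |fderiv ℝ F (stepDiff h h (u · t) x, stepDiff (-h) h (u · t) x) (1, 0)| ≤ M ∧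
      |fderiv ℝ F (stepDiff h h (u · t) x, stepDiff (-h) h (u · t) x) (0, 1)| ≤ M)
    (hsc : ∀ t, 0 < t → ∀ (x : UnitAddCircle) (y : ℝ),
      u (x + (y : UnitAddCircle)) t ≤ u x t + y * v x t + K * y ^ 2)
    (hv : IsSpaceDerivative F u₁ h u v) (hw : IsStepDerivative F h u v w)
    (x : UnitAddCircle) (t : ℝ) (ht : 0 ≤ t) :
    -w x t ≤ L ^ 2 / (2 * √h) + 2 * M * (K + 1 / (2 * √h)) * t := by
  have hs0 : 0 < √h := Real.sqrt_pos.2 hh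
  set θ : ℝ := 1 / (2 * √h) with hθ
  have hθ0 : 0 < θ := by positivity
  have := linearized_le hF hl hr (T := t) (m := L ^ 2 / (2 * √h)) (c := 2 * M * (K + θ))
    (P := fun x t => stepDiff h h (u · t) x) (Q := fun x t => stepDiff (-h) h (u · t) x)
    (z := fun x t => θ * v x t ^ 2 - w x t)
    hh ((continuousOn_const.mul ((hv.continuousOn_Icc t).pow 2)).sub (hw.continuousOn_Icc t))
    (fun x s hs _ => (((hv.hasDerivAt x s hs).pow 2).const_mul θ).sub (hw.hasDerivAt x s hs))
    (fun x => by
      rw [hw.initial, hv.initial, sub_zero, hθ, one_div_mul_eq_div]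
      exact div_le_div_of_nonneg_right (sq_le_sq.2 ((hL x).trans (le_abs_self L))) (by positivity))
    (fun x s hs _ => by
      have hcomp : ∀ r, |r| = h → stepDiff r h (fun x => θ * v x s ^ 2 - w x s) x +
          (stepDiff r h (w · s) x - stepSource r h (u · s) (v · s) x) -
          2 * θ * v x s * stepDiff r h (v · s) x ≤ K + θ := fun r hrh => by
        rw [stepDiff_sub, stepDiff_const_mul]
        have h1 := le_stepSource (U := (u · s)) (v := (v · s)) hh hrh (hsc s hs) x
        -- Discrete chain rule: its defect -h(Dv)² is the dissipation.
        have h2 : stepDiff r h (fun x => v x s ^ 2) x - 2 * v x s * stepDiff r h (v · s) x =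
            -(h * |stepDiff r h (v · s) x| ^ 2) := by
          rw [sq_abs, stepDiff, stepDiff]
          field_simp
          ring
        -- Completing the square; the choice of θ makes 1/(4θh) equal to θ.
        have h3 : |stepDiff r h (v · s) x| - θ * (h * |stepDiff r h (v · s) x| ^ 2) ≤ θ := by
          have e : θ * (h * |stepDiff r h (v · s) x| ^ 2) + θ - |stepDiff r h (v · s) x| =
              θ * (√h * |stepDiff r h (v · s) x| - 1) ^ 2 := by
            have e1 : 2 * θ * √h = 1 := by rw [hθ]; field_simp
            nth_rewrite 1 [← Real.sq_sqrt hh.le]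
            linear_combination |stepDiff r h (v · s) x| * e1
          have := mul_nonneg hθ0.le (sq_nonneg (√h * |stepDiff r h (v · s) x| - 1))
          linarith
        have h4 := congrArg (θ * ·) h2
        simp only at h4
        linarith
      have h5 := gradApply_mono hF hl hr (stepDiff h h (u · s) x) (stepDiff (-h) h (u · s) x)
        (hcomp h (abs_of_pos hh)) (hcomp (-h) (by rw [abs_neg, abs_of_pos hh]))
      have h6 := (le_abs_self _).trans
        (abs_gradApply_le (F := F) (hM x s hs).1 (hM x s hs).2 (K + θ) (K + θ))
      rw [abs_of_nonneg (by positivity : 0 ≤ K + θ)] at h6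
      refine le_trans (le_of_eq ?_) ((h5.trans h6).trans (le_of_eq (by ring)))
      unfold gradApply
      push_cast
      ring) x t ht le_rfl
  have hθv : 0 ≤ θ * v x t ^ 2 := by positivity
  linarith

end Bounds

/-! ### Assembly -/

/-- For h ≤ 1 the one-sided bounds suffice since √h ≤ 1; for h ≥ 1 the crude bound does, since √h ≤
h. -/
theorem abs_le_of_bounds {C t h a : ℝ} (hC : 0 ≤ C) (ht : 0 ≤ t) (hh : 0 < h)
    (hup : h ≤ 1 → a ≤ C * t) (hlo : h ≤ 1 → -a ≤ C * (1 + t) / √h)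
    (hab : |a| ≤ C / h * t) : |a| ≤ C * (1 + t) / √h := by
  have hs0 : 0 < √h := Real.sqrt_pos.2 hh
  rcases le_total h 1 with h1 | h1
  · have hs1 : √h ≤ 1 := Real.sqrt_le_one.2 h1
    refine abs_le.2 ⟨by linarith [hlo h1], (hup h1).trans ?_⟩
    rw [le_div_iff₀ hs0]
    calc C * t * √h ≤ C * t * 1 := by gcongr
      _ ≤ C * (1 + t) := by linarith
  · have hs1 : √h ≤ h := by
      rw [Real.sqrt_le_left hh.le]
      nlinarith
    refine hab.trans ?_
    rw [div_mul_eq_mul_div]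
    calc C * t / h ≤ C * t / √h := div_le_div_of_nonneg_left (by positivity) hs0 hs1
      _ ≤ C * (1 + t) / √h := by gcongr; linarith

theorem mainTheorem2 (F : ℝ × ℝ → ℝ) (u₀ : UnitAddCircle → ℝ)
    (hF_smooth : ContDiff ℝ 2 F)
    (hF_convex : ConvexOn ℝ Set.univ F)
    (hF_mono_left : ∀ q : ℝ, Monotone (fun p : ℝ => F (p, q)))
    (hF_mono_right : ∀ p : ℝ, Monotone (fun q : ℝ => F (p, q)))
    (hu₀ : ContDiff ℝ 2 (fun x : ℝ => u₀ (x : UnitAddCircle))) :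
    (∀ h : ℝ, 0 < h →
      ∃ u : UnitAddCircle → ℝ → ℝ, IsSchemeSolution F u₀ h u ∧
        ∀ w : UnitAddCircle → ℝ → ℝ, IsSchemeSolution F u₀ h w →
          ∀ x : UnitAddCircle, ∀ t : ℝ, 0 ≤ t → w x t = u x t) ∧
    ∃ C : ℝ, 0 < C ∧
      ∀ u : ℝ → UnitAddCircle → ℝ → ℝ, (∀ h : ℝ, 0 < h → IsSchemeSolution F u₀ h (u h)) →
        ∀ h : ℝ, 0 < h → ∀ t : ℝ, 0 < t →
          ∃ uh : C(UnitAddCircle, ℝ),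
            (∀ x : UnitAddCircle, HasDerivAt (fun k : ℝ => u k x t) (uh x) h) ∧
            (∀ x : UnitAddCircle, uh x ≤ C * t) ∧
            (∀ x : UnitAddCircle, -(C * (1 + t) / √h) ≤ uh x) ∧
            ‖uh‖ ≤ C * (1 + t) / √h := by
  obtain ⟨hu₀c, u₁, L, K, hL0, hK0, hL, hL', hK⟩ := exists_torus_taylor_data hu₀
  have hmono : ∀ (x : UnitAddCircle) (t p p' q q' : ℝ), p ≤ p' → q ≤ q' →
      F (p, q) ≤ F (p', q') := fun _ _ _ _ _ _ => monotone_pair hF_mono_left hF_mono_right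
  have hd : Differentiable ℝ F := hF_smooth.differentiable (by norm_num)
  refine ⟨fun h hh => ?_, ?_⟩
  · obtain ⟨u, hu⟩ := exists_isSemidiscreteSolution (Φ := fun _ _ p q => F (p, q))
      (hF_smooth.continuous.comp (by fun_prop)) hmono
      (fun T R => by
        obtain ⟨N, hN⟩ := hF_smooth.exists_abs_sub_le_of_box R
        exact ⟨N, fun _ _ p p' q q' _ => hN p p' q q'⟩) hh ⟨u₀, hu₀c⟩
    exact ⟨u, isSchemeSolution_iff.2 hu, fun w hw x t ht =>
      (isSchemeSolution_iff.1 hw).eq hh hmono hu x t ht⟩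
  obtain ⟨M, hM0, hM⟩ := hF_smooth.exists_abs_fderiv_le_of_box L
  -- The terms serve, in order, positivity, the upper bound, the cost of absorbing |Dv|, the crude
  -- source bound, and the initial value of θv².
  refine ⟨1 + 2 * M * K + M + 4 * M * L + L ^ 2, by positivity, fun u hu h hh t ht => ?_⟩
  set C := 1 + 2 * M * K + M + 4 * M * L + L ^ 2 with hC
  have hMK : 0 ≤ M * K := by positivity
  have hML : 0 ≤ M * L := by positivity
  have hC0 : 0 ≤ C := by positivity
  have hs0 : 0 < √h := Real.sqrt_pos.2 hh
  have hh1 : |h| = h := abs_of_pos hh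
  have hh2 : |-h| = h := by rw [abs_neg, hh1]
  have huh := hu h hh
  have hlip := fun t (ht : 0 ≤ t) x y =>
    huh.abs_shift_sub_le hF_mono_left hF_mono_right hh hL' x y t ht
  have hP : ∀ x t, 0 ≤ t → |stepDiff h h (u h · t) x| ≤ L := fun x t ht =>
    abs_stepDiff_le_of_lipschitz hh hh1 (hlip t ht) x
  have hQ : ∀ x t, 0 ≤ t → |stepDiff (-h) h (u h · t) x| ≤ L := fun x t ht =>
    abs_stepDiff_le_of_lipschitz hh hh2 (hlip t ht) x
  have huc := huh.continuousOn
  obtain ⟨v, hv⟩ : ∃ v, IsSpaceDerivative F u₁ h (u h) v := by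
    simpa only [sub_zero] using exists_linearized hF_smooth hF_mono_left hF_mono_right
      (huc.stepDiff_torus h h) (huc.stepDiff_torus (-h) h) (f := fun _ _ => 0) (g := fun _ _ => 0)
      continuousOn_const continuousOn_const hP hQ hh u₁
  obtain ⟨w, hw⟩ : ∃ w, IsStepDerivative F h (u h) v w :=
    exists_linearized hF_smooth hF_mono_left hF_mono_right
      (huc.stepDiff_torus h h) (huc.stepDiff_torus (-h) h)
      (huc.stepSource_torus hv.continuousOn h h) (huc.stepSource_torus hv.continuousOn (-h) h)
      hP hQ hh 0
  have hvL := fun t (ht : 0 ≤ t) x =>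
    hv.abs_le_of_initial hd hF_mono_left hF_mono_right hh hL x t ht
  have hsc := fun t (ht : 0 < t) x y =>
    hv.shift_le hd hF_convex hF_mono_left hF_mono_right hh hK huh x y t ht.le
  have hMx := fun x t (ht : 0 < t) => hM _ _ (hP x t ht.le) (hQ x t ht.le)
  have hup : ∀ x, w x t ≤ 2 * M * K * t := fun x =>
    hw.le_mul hd hF_mono_left hF_mono_right hh (fun x s hs => by
      have h1 := gradApply_mono hd hF_mono_left hF_mono_right (stepDiff h h (u h · s) x)
        (stepDiff (-h) h (u h · s) x) (stepSource_le (U := (u h · s)) (v := (v · s)) hh hh1 (hsc s hs) x)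
        (stepSource_le (U := (u h · s)) (v := (v · s)) hh hh2 (hsc s hs) x)
      have h2 := (le_abs_self _).trans
        (abs_gradApply_le (hMx x s hs).1 (hMx x s hs).2 K K)
      rw [abs_of_nonneg hK0] at h2
      linarith) x t ht.le
  have hsource : ∀ x s, 0 < s → |gradApply F (stepDiff h h (u h · s) x)
      (stepDiff (-h) h (u h · s) x) (stepSource h h (u h · s) (v · s) x)
      (stepSource (-h) h (u h · s) (v · s) x)| ≤ C / h := fun x s hs => by
    have h1 := abs_stepSource_le (U := (u h · s)) (v := (v · s)) hh hh1 (hlip s hs.le) (hvL s hs.le) x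
    have h2 := abs_stepSource_le (U := (u h · s)) (v := (v · s)) hh hh2 (hlip s hs.le) (hvL s hs.le) x
    refine (abs_gradApply_le (hMx x s hs).1 (hMx x s hs).2 _ _).trans ?_
    calc _ ≤ M * (2 * L / h + 2 * L / h) := by gcongr
      _ = 4 * M * L / h := by ring
      _ ≤ C / h := by
        gcongr
        nlinarith
  have habs : ∀ x, |w x t| ≤ C / h * t := fun x => abs_le.2
    ⟨hw.neg_mul_le hd hF_mono_left hF_mono_right hh
      (fun x s hs => (abs_le.1 (hsource x s hs)).1) x t ht.le,
    hw.le_mul hd hF_mono_left hF_mono_right hh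
      (fun x s hs => (abs_le.1 (hsource x s hs)).2) x t ht.le⟩
  have hupC : ∀ x, w x t ≤ C * t := fun x =>
    (hup x).trans (mul_le_mul_of_nonneg_right (by nlinarith) ht.le)
  have hlow : ∀ x, h ≤ 1 → -w x t ≤ C * (1 + t) / √h := fun x h1 => by
    refine (hw.neg_le_of_semiconcave hd hF_mono_left hF_mono_right hh hK0 hL hMx hsc hv x t
      ht.le).trans ?_
    have hs1 : √h ≤ 1 := Real.sqrt_le_one.2 h1
    rw [le_div_iff₀ hs0]
    have e : (L ^ 2 / (2 * √h) + 2 * M * (K + 1 / (2 * √h)) * t) * √h =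
        L ^ 2 / 2 + 2 * (M * K * t) * √h + M * t := by field_simp; ring
    rw [e]
    have hMKt : 0 ≤ M * K * t := by positivity
    have hMLt : 0 ≤ M * L * t := by positivity
    have hL2t : 0 ≤ L ^ 2 * t := by positivity
    have h3 := mul_le_of_le_one_right hMKt hs1
    rw [hC]
    nlinarith [sq_nonneg L]
  have hwb : ∀ x, |w x t| ≤ C * (1 + t) / √h := fun x =>
    abs_le_of_bounds hC0 ht.le hh (fun _ => hupC x) (hlow x) (habs x)
  have hwc : Continuous fun x => w x t :=
    hw.continuousOn.comp_continuous (f := fun x => (x, t)) (by fun_prop)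
      fun x => ⟨mem_univ _, ht.le⟩
  refine ⟨⟨fun x => w x t, hwc⟩, fun x => ?_, hupC, fun x => (abs_le.1 (hwb x)).1,
    (ContinuousMap.norm_le _ (by positivity)).2 hwb⟩
  rw [hasDerivAt_iff_isLittleO, Asymptotics.isLittleO_iff]
  intro r hr
  obtain ⟨δ, hδ, H⟩ := hw.abs_sub_le hF_smooth hF_mono_left hF_mono_right hh hL hL' hK huh hv ht hr
  -- The family solves the scheme only for positive steps, so k is also kept positive.
  filter_upwards [Metric.closedBall_mem_nhds h hδ, Ioi_mem_nhds hh] with k hk hk0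
  have := H (k - h) hk (u k) (by rw [add_sub_cancel]; exact hu k hk0) x
  simpa [Real.norm_eq_abs] using this
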